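/- Consider oriented site percolation on the triangular lattice, realised on $\mathbb{Z}^2$ as follows: each site is independently occupied with probability $p\in[0,1]$ and vacant with probability $1-p$; an occupied site $x$ has directed edges to $x+(-1,0)$, $x+(0,1)$ and $x+(-1,1)$, and a vacant site has no outgoing edges. Let $\mathbf{C}_o$ be the forward cluster of the origin $o$, i.e. the set of sites $y$ that can be reached from $o$ by a finite (possibly trivial) directed path. Let $\Theta_+(p)=\mathbb{P}_p(|\mathbf{C}_o|=\infty)$ and $p_c=\inf\{p\in[0,1]:\Theta_+(p)>0\}$, and for $n\ge 0$ let $$w_n=\sup\{x\in\mathbb{Z}:(-n,x)\in\mathbf{C}_o\},\qquad v_n=\inf\{x\in\mathbb{Z}:(-n,x)\in\mathbf{C}_o\}$$ (in the extended reals). Then for every $p$ with $p_c<p<1$ there exists a real number $\rho=\rho_p<-1$ such that, $\mathbb{P}_p$-almost surely on the event $\{|\mathbf{C}_o|=\infty\}$, the upper and lower boundaries of $\mathbf{C}_o$ have asymptotic slopes $\rho$ and $1/\rho$ respectively, that is, $$\frac{w_n}{-n}\to\rho\qquad\text{and}\qquad\frac{v_n}{-n}\to\frac1\rho\qquad\text{as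 } n\to\infty.$$ -/

import Mathlib

open MeasureTheory ProbabilityTheory Filter Topology

namespace OTSP

/-- The three steps available at an occupied site: west, north and north-west. (Joining each site
of `ℤ × ℤ` to its nearest neighbours and along these diagonals gives the triangular lattice.) -/
def steps : Set (ℤ × ℤ) := {(-1, 0), (0, 1), (-1, 1)}

/-- A configuration: `ω x = true` when the site `x` is occupied. -/
abbrev Config : Type := ℤ × ℤ → Bool

/-- The local environment at `x`: all three steps if `x` is occupied, none otherwise. -/
def localEnv (ω : Config) (x : ℤ × ℤ) : Set (ℤ × ℤ) := {e | ω x = true ∧ e ∈ steps}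

/-- `x → y`: there is a finite sequence (possibly of length `0`) from `x` to `y`, each of whose
increments belongs to the local environment of the site it leaves. -/
def Connected (ω : Config) : ℤ × ℤ → ℤ × ℤ → Prop :=
  Relation.ReflTransGen fun a b => b - a ∈ localEnv ω a

/-- The forward cluster of `x`. -/
def forwardCluster (ω : Config) (x : ℤ × ℤ) : Set (ℤ × ℤ) := {y | Connected ω x y}

/-- The law of the configuration: the sites are independently occupied with probability `p`. -/
noncomputable def law (p : unitInterval) : Measure Config :=
  Measure.infinitePi fun _ : ℤ × ℤ => bernoulliMeasure true false p

/-- The probability that the forward cluster of the origin is infinite. -/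
noncomputable def percProb (p : unitInterval) : ENNReal :=
  law p {ω | (forwardCluster ω 0).Infinite}

/-- The critical value, as an infimum in the complete lattice `[0, 1]`. -/
noncomputable def criticalValue : unitInterval := sInf {p | 0 < percProb p}

/-- `w_n = sup {x : (-n, x) ∈ C_o}`, in the extended reals. -/
noncomputable def upper (ω : Config) (n : ℕ) : EReal :=
  ⨆ x ∈ {x : ℤ | (-(n : ℤ), x) ∈ forwardCluster ω 0}, ((x : ℝ) : EReal)

/-- `v_n = inf {x : (-n, x) ∈ C_o}`, in the extended reals. -/
noncomputable def lower (ω : Config) (n : ℕ) : EReal :=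
  ⨅ x ∈ {x : ℤ | (-(n : ℤ), x) ∈ forwardCluster ω 0}, ((x : ℝ) : EReal)

end OTSP

/-!
Number the columns from right to left, starting at that of the origin. Within a column paths only
climb, so the reachable sites of a column are determined by its entry points, and each column acts
on sets of entry points by a random map that commutes with unions. Let `top n` be the highest entry
point of column `n` for paths started from the whole lower half of column `0`. Given that the path
from the origin survives, column `n` is a renewal when its highest entry point itself survives:
between renewals the environments are i.i.d., and the strong law of large numbers gives
`top n / n → l`. The rise between renewals is integrable by a converse to the strong law, since
`top n / n` is squeezed between `0` and a convergent average of run lengths.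

Independence of a survival event and the columns to its right transfers the slope to the mean,
`𝔼 (top n) / n → l`. Raising the density from `q` to `p` in one column raises the highest entry
point of the next one by at least one with probability at least `p - q`, and by translation
invariance raising the starting half-line by one raises the mean of `top` by exactly one; hence
`l(q) + (p - q) ≤ l(p)`.

Reflection in the antidiagonal preserves the steps and exchanges the two boundaries, so the lower
boundary has slope `1 / l`. As the lower boundary lies below the upper one, `1 ≤ l(q)` whenever
percolation occurs at `q`, and `1 < l(p)` for `p > p_c`. With columns numbered from right to left,
`ρ = -l`.
-/

namespace OTSP

section MeasureTheory

variable {Ω Ω' α : Type*} [MeasurableSpace Ω] [MeasurableSpace Ω'] {μ : Measure Ω}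
  {μ' : Measure Ω'}

lemma measure_eq_tsum_inter_preimage_singleton [Countable α] [MeasurableSpace α]
    [MeasurableSingletonClass α] (μ : Measure Ω) {F : Ω → α} (hF : Measurable F) (E : Set Ω) :
    μ E = ∑' a, μ (E ∩ F ⁻¹' {a}) := by
  have h := tsum_measure_preimage_singleton (μ := μ.restrict E) (Set.countable_univ)
    (f := F) fun a _ => hF (measurableSet_singleton a)
  rw [Set.preimage_univ, Measure.restrict_apply_univ] at h
  rw [← h, tsum_univ (f := fun a => μ.restrict E (F ⁻¹' {a}))]
  refine tsum_congr fun a => ?_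
  rw [Measure.restrict_apply (hF (measurableSet_singleton a)), Set.inter_comm]

open Classical in
lemma measurable_nat_sInf {P : ℕ → Ω → Prop} (hP : ∀ k, Measurable (P k)) :
    Measurable fun ω => sInf {k | P k ω} := by
  -- Adding the alternative `∀ j, ¬ P j ω` makes the search succeed, with value `0 = sInf ∅`.
  have hex : ∀ ω, ∃ k, P k ω ∨ ∀ j, ¬ P j ω := fun ω => by
    by_cases h : ∃ k, P k ω
    · exact h.imp fun _ => Or.inl
    · exact ⟨0, Or.inr (not_exists.1 h)⟩
  have heq : (fun ω => sInf {k | P k ω}) = fun ω => Nat.find (hex ω) := by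
    funext ω
    by_cases h : ∃ k, P k ω
    · have hno : ¬ ∀ j, ¬ P j ω := fun hno => h.elim hno
      have hne : {k | P k ω}.Nonempty := h
      rw [Nat.sInf_def hne]
      exact Nat.find_congr' (by simp [hno])
    · have hno : ∀ j, ¬ P j ω := not_exists.1 h
      have hempty : {k | P k ω} = ∅ := Set.eq_empty_of_forall_notMem hno
      rw [hempty, Nat.sInf_empty, eq_comm, Nat.find_eq_zero]
      exact Or.inr hno
  rw [heq]
  exact measurable_find hex fun k => measurableSet_setOfPred.2
    ((hP k).or (Measurable.forall fun j => (hP j).not))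

lemma int_csSup_eq_iff {E : Set ℤ} {m : ℤ} :
    sSup E = m ↔ IsGreatest E m ∨ (¬ (E.Nonempty ∧ BddAbove E) ∧ m = 0) := by
  constructor
  · rintro rfl
    by_cases h : E.Nonempty ∧ BddAbove E
    · exact Or.inl ⟨Int.csSup_mem h.1 h.2, fun z hz => le_csSup h.2 hz⟩
    · refine Or.inr ⟨h, ?_⟩
      rcases not_and_or.1 h with hne | hb
      · rw [Set.not_nonempty_iff_eq_empty.1 hne, Int.csSup_empty]
      · exact Int.csSup_of_not_bddAbove hb
  · rintro (h | ⟨h, rfl⟩)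
    · exact h.csSup_eq
    · rcases not_and_or.1 h with hne | hb
      · rw [Set.not_nonempty_iff_eq_empty.1 hne, Int.csSup_empty]
      · exact Int.csSup_of_not_bddAbove hb

lemma measurable_int_sSup {E : Ω → Set ℤ} (hE : ∀ z, Measurable fun ω => z ∈ E ω) :
    Measurable fun ω => sSup (E ω) := by
  have hbdd : ∀ b, Measurable fun ω => ∀ z, z ∈ E ω → z ≤ b :=
    fun b => Measurable.forall fun z => (hE z).imp measurable_const
  refine measurable_to_countable' fun m => ?_
  have : (fun ω => sSup (E ω)) ⁻¹' {m} = {ω | (m ∈ E ω ∧ ∀ z, z ∈ E ω → z ≤ m) ∨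
      (¬ ((∃ z, z ∈ E ω) ∧ ∃ b, ∀ z, z ∈ E ω → z ≤ b) ∧ m = 0)} :=
    Set.ext fun ω => int_csSup_eq_iff
  rw [this, measurableSet_setOfPred]
  exact ((hE m).and (hbdd m)).or
    (((Measurable.exists hE).and (Measurable.exists hbdd)).not.and measurable_const)

lemma measurableSet_iSup_comap_of_dependsOn {ι S : Type*} [Nonempty S] [MeasurableSpace S]
    {I : Set ι} {D : Set (ι → S)} (hD : MeasurableSet D) (hDI : DependsOn (· ∈ D) I) :
    MeasurableSet[⨆ i ∈ I, MeasurableSpace.comap (fun ω : ι → S => ω i) inferInstance] D := by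
  classical
  let freeze : (ι → S) → ι → S := fun ω i => if i ∈ I then ω i else Classical.arbitrary S
  have hDf : D = freeze ⁻¹' D := by
    ext ω
    exact iff_of_eq (hDI fun i hi => (if_pos hi).symm)
  have hfreeze : Measurable[⨆ i ∈ I,
      MeasurableSpace.comap (fun ω : ι → S => ω i) inferInstance] freeze := by
    refine @measurable_pi_lambda _ _ _ (_) _ _ fun i => ?_
    by_cases hi : i ∈ I
    · simp only [freeze, hi, if_true]
      exact (comap_measurable _).mono (le_iSup₂_of_le i hi le_rfl) le_rfl
    · simp only [freeze, hi, if_false]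
      exact measurable_const
  rw [hDf]
  exact hfreeze hD

lemma infinitePi_forall_row_mem {ι S : Type*} [MeasurableSpace S] (ν : Measure S)
    [IsProbabilityMeasure ν] {g : ℕ × ℕ → ι} (hg : Function.Injective g) {T : Set (ℕ → S)}
    (hT : MeasurableSet T) (m : ℕ) :
    Measure.infinitePi (fun _ : ι => ν) {ω | ∀ k < m, (fun i => ω (g (k, i))) ∈ T} =
      Measure.infinitePi (fun _ : ℕ => ν) T ^ m := by
  have hrows : MeasurableSet (Set.pi (Finset.range m : Set ℕ) fun _ => T) :=
    MeasurableSet.pi (Finset.countable_toSet _) fun _ _ => hT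
  have h := Measure.infinitePi_pi (fun _ : ℕ => Measure.infinitePi fun _ : ℕ => ν)
    (s := Finset.range m) (t := fun _ => T) fun _ _ => hT
  rw [← Measure.infinitePi_map_curry (fun _ _ : ℕ => ν),
    Measure.map_apply (MeasurableEquiv.measurable _) hrows,
    ← Measure.map_infinitePi_infinitePi_of_inj (P := fun _ : ι => ν) hg,
    Measure.map_apply (by fun_prop) ((MeasurableEquiv.measurable _) hrows),
    Finset.prod_const, Finset.card_range] at h
  rw [← h]
  congr 1
  ext ω
  exact forall_congr' fun k => imp_congr Finset.mem_range.symm Iff.rfl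

lemma lintegral_natCast_eq_tsum (μ : Measure Ω) {X : Ω → ℕ} (hX : Measurable X) :
    ∫⁻ ω, (X ω : ENNReal) ∂μ = ∑' m : ℕ, μ {ω | m < X ω} := by
  have h : ∀ ω, (X ω : ENNReal) = ∑' m : ℕ, Set.indicator {ω | m < X ω} (fun _ => 1) ω := by
    intro ω
    rw [tsum_eq_sum (s := Finset.range (X ω)) fun m hm => Set.indicator_of_notMem
      (s := {ω | m < X ω}) (fun h => hm (Finset.mem_range.2 h)) _]
    rw [Finset.sum_congr rfl fun m hm => Set.indicator_of_mem
      (s := {ω | m < X ω}) (Finset.mem_range.1 hm) _]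
    simp
  have hm : ∀ m : ℕ, MeasurableSet {ω | m < X ω} := fun m => hX (measurableSet_Ioi (a := m))
  simp_rw [h]
  rw [lintegral_tsum fun m => (measurable_const.indicator (hm m)).aemeasurable]
  exact tsum_congr fun m => lintegral_indicator_one (hm m)

lemma integrable_natCast_of_tsum_lt_top {X : Ω → ℕ} (hX : Measurable X)
    (h : ∑' m : ℕ, μ {ω | m < X ω} < ⊤) : Integrable (fun ω => (X ω : ℝ)) μ := by
  refine ⟨(measurable_from_top.comp hX).aestronglyMeasurable, ?_⟩
  rw [HasFiniteIntegral]
  simpa [lintegral_natCast_eq_tsum μ hX] using h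

lemma integrable_natCast_of_le_pow {X : Ω → ℕ} (hX : Measurable X) {r : ENNReal} (hr : r < 1)
    (h : ∀ m, μ {ω | m < X ω} ≤ r ^ m) : Integrable (fun ω => (X ω : ℝ)) μ := by
  refine integrable_natCast_of_tsum_lt_top hX ((ENNReal.tsum_le_tsum h).trans_lt ?_)
  rw [ENNReal.tsum_geometric]
  simpa using hr

lemma measure_eq_zero_of_le_pow {s : Set Ω} {r : ENNReal} (hr : r < 1)
    (h : ∀ m : ℕ, μ s ≤ r ^ m) : μ s = 0 :=
  le_antisymm (ge_of_tendsto' (ENNReal.tendsto_pow_atTop_nhds_zero_of_lt_one hr) h) zero_le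

lemma integral_comp_measurePreserving {φ : Ω → Ω'} (hφ : MeasurePreserving φ μ μ') {f : Ω' → ℝ}
    (hf : Measurable f) : ∫ ω, f (φ ω) ∂μ = ∫ ω, f ω ∂μ' := by
  rw [← hφ.map_eq, integral_map hφ.aemeasurable hf.aestronglyMeasurable]

lemma indepFun_comp_measurePreserving {β γ : Type*} [MeasurableSpace β] [MeasurableSpace γ]
    {T : Ω → Ω'} (hT : MeasurePreserving T μ μ') {f : Ω' → β} {g : Ω' → γ} (hf : Measurable f)
    (hg : Measurable g) (h : IndepFun f g μ') :
    IndepFun (fun ω => f (T ω)) (fun ω => g (T ω)) μ := by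
  rw [indepFun_iff_measure_inter_preimage_eq_mul] at h ⊢
  intro s t hs ht
  have := h s t hs ht
  rw [← hT.measure_preimage ((hf hs).inter (hg ht)).nullMeasurableSet,
    ← hT.measure_preimage (hf hs).nullMeasurableSet,
    ← hT.measure_preimage (hg ht).nullMeasurableSet] at this
  exact this

section Fibers

variable [Countable α] [MeasurableSpace α] [MeasurableSingletonClass α] {F : Ω → α} {T : Ω → Ω}

lemma measure_preimage_inter_eq_mul_of_singleton (hF : Measurable F)
    (h : ∀ a C, MeasurableSet C → μ (F ⁻¹' {a} ∩ T ⁻¹' C) = μ (F ⁻¹' {a}) * μ C) (B : Set α)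
    {C : Set Ω} (hC : MeasurableSet C) : μ (F ⁻¹' B ∩ T ⁻¹' C) = μ (F ⁻¹' B) * μ C := by
  rw [measure_eq_tsum_inter_preimage_singleton μ hF (F ⁻¹' B ∩ _),
    measure_eq_tsum_inter_preimage_singleton μ hF (F ⁻¹' B), ← ENNReal.tsum_mul_right]
  refine tsum_congr fun a => ?_
  by_cases ha : a ∈ B
  · have hfib : F ⁻¹' B ∩ F ⁻¹' {a} = F ⁻¹' {a} :=
      Set.inter_eq_right.2 (Set.preimage_mono (Set.singleton_subset_iff.2 ha))
    rw [Set.inter_right_comm, hfib, h a C hC]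
  · have hfib : F ⁻¹' B ∩ F ⁻¹' {a} = ∅ := by
      rw [← Set.preimage_inter, Set.inter_singleton_eq_empty.2 ha, Set.preimage_empty]
    rw [Set.inter_right_comm, hfib]
    simp

variable [IsProbabilityMeasure μ]

lemma measurePreserving_of_singleton (hF : Measurable F) (hT : Measurable T)
    (h : ∀ a C, MeasurableSet C → μ (F ⁻¹' {a} ∩ T ⁻¹' C) = μ (F ⁻¹' {a}) * μ C) :
    MeasurePreserving T μ μ := by
  refine ⟨hT, Measure.ext fun C hC => ?_⟩
  rw [Measure.map_apply hT hC]
  simpa using measure_preimage_inter_eq_mul_of_singleton hF h Set.univ hC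

lemma indepFun_of_singleton (hF : Measurable F) (hT : Measurable T)
    (h : ∀ a C, MeasurableSet C → μ (F ⁻¹' {a} ∩ T ⁻¹' C) = μ (F ⁻¹' {a}) * μ C) :
    IndepFun F T μ := by
  rw [indepFun_iff_measure_inter_preimage_eq_mul]
  intro s t _ ht
  rw [measure_preimage_inter_eq_mul_of_singleton hF h s ht,
    (measurePreserving_of_singleton hF hT h).measure_preimage ht.nullMeasurableSet]

end Fibers

end MeasureTheory

section LimitTheorems

variable {Ω Ω' : Type*} [MeasurableSpace Ω] [MeasurableSpace Ω'] {μ : Measure Ω}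
  {μ' : Measure Ω'}

lemma strong_law_comp_measurePreserving {φ : ℕ → Ω → Ω'}
    (hφ : ∀ i, MeasurePreserving (φ i) μ μ') {f : Ω' → ℝ} (hf : Measurable f)
    (hind : ∀ i j, i < j → IndepFun (fun ω => f (φ i ω)) (fun ω => f (φ j ω)) μ)
    (hint : Integrable f μ') :
    ∀ᵐ ω ∂μ, Tendsto (fun n : ℕ => (∑ i ∈ Finset.range n, f (φ i ω)) / n) atTop
      (𝓝 (∫ ω, f ω ∂μ')) := by
  have hmap : ∀ i, μ.map (fun ω => f (φ i ω)) = μ'.map f := fun i => by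
    rw [← (hφ i).map_eq, Measure.map_map hf (hφ i).measurable]
    rfl
  have hae : ∀ i, AEMeasurable (fun ω => f (φ i ω)) μ := fun i =>
    (hf.comp (hφ i).measurable).aemeasurable
  rw [← integral_comp_measurePreserving (hφ 0) hf]
  refine strong_law_ae_real (fun i ω => f (φ i ω)) ((hφ 0).integrable_comp_of_integrable hint)
    (fun i j hij => ?_) fun i => ⟨hae i, hae 0, by rw [hmap, hmap]⟩
  rcases lt_or_gt_of_ne hij with h | h
  · exact hind i j h
  · exact (hind j i h).symm

variable {T : Ω → Ω} {f : Ω → ℝ}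

lemma strong_law_iterate (hT : MeasurePreserving T μ μ) (hf : Measurable f)
    (hind : IndepFun f T μ) (hint : Integrable f μ) :
    ∀ᵐ ω ∂μ, Tendsto (fun n : ℕ => (∑ i ∈ Finset.range n, f (T^[i] ω)) / n) atTop
      (𝓝 (∫ ω, f ω ∂μ)) := by
  refine strong_law_comp_measurePreserving hT.iterate hf (fun i j hij => ?_) hint
  obtain ⟨d, rfl⟩ := Nat.exists_eq_add_of_lt hij
  have hstep : IndepFun f (fun ω => f (T^[d] (T ω))) μ :=
    hind.comp measurable_id (hf.comp (hT.iterate d).measurable)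
  convert indepFun_comp_measurePreserving (hT.iterate i) hf
    (hf.comp ((hT.iterate d).measurable.comp hT.measurable)) hstep using 2 with ω
  rw [Function.comp_apply, Function.comp_apply, ← Function.iterate_succ_apply,
    ← Function.iterate_add_apply]
  congr 2
  lia

/- Converse to the strong law: it is applied to the bounded truncations `min f K`, whose integrals
are therefore at most `C`. -/
lemma integrable_of_sum_iterate_le [IsProbabilityMeasure μ] (hT : MeasurePreserving T μ μ)
    (hf : Measurable f) (hf0 : 0 ≤ᵐ[μ] f) (hind : IndepFun f T μ) {b : ℕ → Ω → ℝ} {C : ℝ}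
    (hb : ∀ᵐ ω ∂μ, ∀ n, ∑ i ∈ Finset.range n, f (T^[i] ω) ≤ b n ω)
    (hlim : ∀ᵐ ω ∂μ, Tendsto (fun n => b n ω / n) atTop (𝓝 C)) : Integrable f μ := by
  have hmeas : ∀ K : ℕ, Measurable fun ω => min (f ω) K := fun K => hf.min measurable_const
  have htrunc : ∀ K : ℕ, 0 ≤ᵐ[μ] fun ω => min (f ω) K := fun K =>
    hf0.mono fun ω h => le_min h K.cast_nonneg
  have hint : ∀ K : ℕ, Integrable (fun ω => min (f ω) K) μ := fun K => by
    refine Integrable.of_bound (C := (K : ℝ)) (hmeas K).aestronglyMeasurable ?_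
    filter_upwards [htrunc K] with ω hω
    exact (Real.norm_of_nonneg hω).trans_le (min_le_right _ _)
  have hle : ∀ K : ℕ, ∫ ω, min (f ω) K ∂μ ≤ C := fun K => by
    have hindK : IndepFun (fun ω => min (f ω) K) T μ :=
      hind.comp (measurable_id.min measurable_const) measurable_id
    obtain ⟨ω, hslln, hsum, hC⟩ :=
      ((strong_law_iterate hT (hmeas K) hindK (hint K)).and (hb.and hlim)).exists
    exact le_of_tendsto_of_tendsto' hslln hC fun n => div_le_div_of_nonneg_right
      ((Finset.sum_le_sum fun i _ => min_le_left _ _).trans (hsum n)) n.cast_nonneg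
  have hlint : Tendsto (fun K : ℕ => ∫⁻ ω, ENNReal.ofReal (min (f ω) K) ∂μ) atTop
      (𝓝 (∫⁻ ω, ENNReal.ofReal (f ω) ∂μ)) := by
    refine lintegral_tendsto_of_tendsto_of_monotone
      (fun K => (hmeas K).ennreal_ofReal.aemeasurable) (ae_of_all _ fun ω K L hKL => ?_)
      (ae_of_all _ fun ω => tendsto_const_nhds.congr' ?_)
    · exact ENNReal.ofReal_le_ofReal (min_le_min_left _ (Nat.cast_le.2 hKL))
    · filter_upwards [eventually_ge_atTop ⌈f ω⌉₊] with K hK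
      rw [min_eq_left (Nat.ceil_le.1 hK)]
  refine ⟨hf.aestronglyMeasurable, ?_⟩
  rw [hasFiniteIntegral_iff_ofReal hf0]
  refine (le_of_tendsto' hlint fun K => ?_).trans_lt (ENNReal.ofReal_lt_top (r := C))
  rw [← ofReal_integral_eq_lintegral_ofReal (hint K) (htrunc K)]
  exact ENNReal.ofReal_le_ofReal (hle K)

/- A form of Fatou's lemma in which convergence is only known on `A = ⋃ n, E n`. On `E n ⊆ A` the
deficit `L - f n` is at most its positive part on `A`, whose integral tends to zero by dominated
convergence, and independence divides out the probability of `E n`. -/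
lemma eventually_lt_integral_of_tendsto_on_iUnion [IsFiniteMeasure μ] {f : ℕ → Ω → ℝ}
    {E : ℕ → Set Ω} {θ L a : ℝ} (hf : ∀ n, Measurable (f n)) (hf0 : ∀ᵐ ω ∂μ, ∀ n, 0 ≤ f n ω)
    (hint : ∀ n, Integrable (f n) μ) (hE : ∀ n, MeasurableSet (E n)) (hθ : 0 < θ)
    (hEθ : ∀ n, μ.real (E n) = θ)
    (hind : ∀ n, ∫ ω in E n, f n ω ∂μ = μ.real (E n) * ∫ ω, f n ω ∂μ)
    (hlim : ∀ᵐ ω ∂μ, ω ∈ ⋃ n, E n → Tendsto (fun n => f n ω) atTop (𝓝 L)) (ha : a < L) :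
    ∀ᶠ n in atTop, a < ∫ ω, f n ω ∂μ := by
  let A : Set Ω := ⋃ n, E n
  have hA : MeasurableSet A := MeasurableSet.iUnion hE
  let deficit : ℕ → Ω → ℝ := fun n ω => max (L - f n ω) 0
  have hmeas : ∀ n, Measurable (deficit n) := fun n =>
    (measurable_const.sub (hf n)).max measurable_const
  have hbound : ∀ n, ∀ᵐ ω ∂μ, ‖deficit n ω‖ ≤ |L| := fun n => by
    filter_upwards [hf0] with ω hω
    rw [Real.norm_of_nonneg (le_max_right _ _)]
    exact max_le (by linarith [hω n, le_abs_self L]) (abs_nonneg _)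
  have hdint : ∀ n, Integrable (deficit n) μ := fun n =>
    Integrable.of_bound (hmeas n).aestronglyMeasurable _ (hbound n)
  have hzero : Tendsto (fun n => ∫ ω in A, deficit n ω ∂μ) atTop (𝓝 0) := by
    rw [← integral_zero Ω ℝ (μ := μ.restrict A)]
    refine tendsto_integral_of_dominated_convergence (fun _ => |L|)
      (fun n => (hmeas n).aestronglyMeasurable) (integrable_const _)
      (fun n => ae_restrict_of_ae (hbound n)) ((ae_restrict_iff' hA).2 ?_)
    filter_upwards [hlim] with ω hω hωA
    simpa using ((tendsto_const_nhds (x := L)).sub (hω hωA)).max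
      (tendsto_const_nhds (x := (0 : ℝ)))
  have hdef : ∀ n, θ * (L - ∫ ω, f n ω ∂μ) ≤ ∫ ω in A, deficit n ω ∂μ := fun n => by
    calc θ * (L - ∫ ω, f n ω ∂μ) = ∫ ω in E n, (L - f n ω) ∂μ := by
          rw [integral_sub (integrable_const _) (hint n).integrableOn, hind, setIntegral_const,
            hEθ, smul_eq_mul, mul_sub]
      _ ≤ ∫ ω in E n, deficit n ω ∂μ :=
          integral_mono ((integrable_const _).sub (hint n).integrableOn) (hdint n).integrableOn
            fun ω => le_max_left _ _
      _ ≤ ∫ ω in A, deficit n ω ∂μ :=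
          setIntegral_mono_set (hdint n).integrableOn (ae_of_all _ fun ω => le_max_right _ _)
            (Set.subset_iUnion E n).eventuallyLE
  filter_upwards [hzero.eventually_lt_const (mul_pos hθ (sub_pos.2 ha))] with n hn
  have := lt_of_mul_lt_mul_left ((hdef n).trans_lt hn) hθ.le
  linarith

end LimitTheorems

section RenewalTimes

variable {T : ℕ → ℕ}

lemma exists_le_and_lt_succ (hT : StrictMono T) (hT0 : T 0 = 0) (n : ℕ) :
    ∃ k, T k ≤ n ∧ n < T (k + 1) := by
  refine ⟨Nat.findGreatest (fun k => T k ≤ n) n,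
    Nat.findGreatest_spec (P := fun k => T k ≤ n) (Nat.zero_le n) (by simp [hT0]), ?_⟩
  by_contra! hle
  exact absurd (Nat.le_findGreatest (P := fun k => T k ≤ n) ((hT.id_le _).trans hle) hle)
    (Nat.not_succ_le_self _)

lemma tendsto_atTop_of_lt_succ (hT : Monotone T) {κ : ℕ → ℕ} (hκ : ∀ n, n < T (κ n + 1)) :
    Tendsto κ atTop atTop := by
  refine tendsto_atTop.2 fun b => ?_
  filter_upwards [eventually_ge_atTop (T b)] with n hn
  by_contra! hlt
  exact absurd (hκ n) (not_lt.2 ((hT (by lia)).trans hn))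

lemma tendsto_succ_div {u : ℕ → ℝ} {c : ℝ} (hu : Tendsto (fun n : ℕ => u n / n) atTop (𝓝 c)) :
    Tendsto (fun n : ℕ => u (n + 1) / n) atTop (𝓝 c) := by
  have h := (hu.comp (tendsto_add_atTop_nat 1)).mul
    ((tendsto_const_nhds (x := (1 : ℝ))).add tendsto_one_div_atTop_nhds_zero_nat)
  rw [add_zero, mul_one] at h
  refine h.congr' ?_
  filter_upwards [eventually_gt_atTop 0] with n hn
  have : (n : ℝ) ≠ 0 := Nat.cast_ne_zero.2 hn.ne'
  simp only [Function.comp_apply, Nat.cast_add, Nat.cast_one]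
  field_simp

lemma tendsto_pred_div {u : ℕ → ℝ} {c : ℝ} (hu : Tendsto (fun n : ℕ => u n / n) atTop (𝓝 c)) :
    Tendsto (fun n : ℕ => u (n - 1) / n) atTop (𝓝 c) := by
  rw [← tendsto_add_atTop_iff_nat 1]
  have h := hu.mul (tendsto_natCast_div_add_atTop (𝕜 := ℝ) (1 : ℝ))
  rw [mul_one] at h
  refine h.congr' ?_
  filter_upwards [eventually_gt_atTop 0] with n hn
  rw [div_mul_div_cancel₀ (Nat.cast_ne_zero.2 hn.ne'), Nat.add_sub_cancel, Nat.cast_add,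
    Nat.cast_one]

lemma tendsto_natCast_div_of_le_of_le_succ {u : ℕ → ℝ} {m : ℝ}
    (hu : Tendsto (fun k : ℕ => u k / k) atTop (𝓝 m)) {κ : ℕ → ℕ} (hκ : Tendsto κ atTop atTop)
    (hlower : ∀ᶠ n : ℕ in atTop, u (κ n) ≤ n) (hupper : ∀ᶠ n : ℕ in atTop, (n : ℝ) ≤ u (κ n + 1)) :
    Tendsto (fun n : ℕ => (n : ℝ) / κ n) atTop (𝓝 m) :=
  tendsto_of_tendsto_of_tendsto_of_le_of_le' (hu.comp hκ) ((tendsto_succ_div hu).comp hκ)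
    (hlower.mono fun _ h => div_le_div_of_nonneg_right h (Nat.cast_nonneg _))
    (hupper.mono fun _ h => div_le_div_of_nonneg_right h (Nat.cast_nonneg _))

lemma tendsto_comp_div_of_tendsto_div {u : ℕ → ℝ} {h m : ℝ} (hm : m ≠ 0)
    (hu : Tendsto (fun k : ℕ => u k / k) atTop (𝓝 h)) {κ : ℕ → ℕ} (hκ : Tendsto κ atTop atTop)
    (hκm : Tendsto (fun n : ℕ => (n : ℝ) / κ n) atTop (𝓝 m)) :
    Tendsto (fun n : ℕ => u (κ n) / n) atTop (𝓝 (h / m)) := by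
  refine ((hu.comp hκ).div hκm hm).congr' ?_
  filter_upwards [hκ.eventually_gt_atTop 0] with n hn
  have : (κ n : ℝ) ≠ 0 := by positivity
  exact div_div_div_cancel_right₀ this _ _

/- With `κ n` the number of renewals up to time `n`, the increment of `a` since the last renewal is
at most `s n - s (T (κ n))`, which is `o(n)` since `T (κ n) / n → 1`. -/
lemma tendsto_div_of_tendsto_comp_div (hT : StrictMono T) (hT0 : T 0 = 0) {a s : ℕ → ℝ}
    {m h c : ℝ} (hm : m ≠ 0) (hTm : Tendsto (fun k : ℕ => (T k : ℝ) / k) atTop (𝓝 m))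
    (hah : Tendsto (fun k : ℕ => a (T k) / k) atTop (𝓝 h))
    (hs : Tendsto (fun n : ℕ => s n / n) atTop (𝓝 c))
    (hlow : ∀ k n, T k ≤ n → a (T k) ≤ a n)
    (hup : ∀ k n, T k ≤ n → a n ≤ a (T k) + (s n - s (T k))) :
    Tendsto (fun n : ℕ => a n / n) atTop (𝓝 (h / m)) := by
  choose κ hle hlt using exists_le_and_lt_succ hT hT0
  have hκ : Tendsto κ atTop atTop := tendsto_atTop_of_lt_succ hT.monotone hlt
  have hκm := tendsto_natCast_div_of_le_of_le_succ hTm hκ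
    (.of_forall fun n => Nat.cast_le.2 (hle n)) (.of_forall fun n => Nat.cast_le.2 (hlt n).le)
  have haκ : Tendsto (fun n : ℕ => a (T (κ n)) / n) atTop (𝓝 (h / m)) :=
    tendsto_comp_div_of_tendsto_div hm hah hκ hκm
  have hTκ : Tendsto (fun n : ℕ => (n : ℝ) / T (κ n)) atTop (𝓝 1) := by
    have := (tendsto_comp_div_of_tendsto_div hm hTm hκ hκm).inv₀
      (div_ne_zero hm hm)
    simpa only [inv_div, div_self hm, inv_one] using this
  have hsκ : Tendsto (fun n : ℕ => s (T (κ n)) / n) atTop (𝓝 c) := by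
    simpa using tendsto_comp_div_of_tendsto_div one_ne_zero hs (hT.tendsto_atTop.comp hκ) hTκ
  have hupper : Tendsto (fun n : ℕ => a (T (κ n)) / n + (s n / n - s (T (κ n)) / n)) atTop
      (𝓝 (h / m)) := by
    simpa using haκ.add (hs.sub hsκ)
  refine tendsto_of_tendsto_of_tendsto_of_le_of_le haκ hupper (fun n => ?_) (fun n => ?_)
  · exact div_le_div_of_nonneg_right (hlow _ _ (hle n)) n.cast_nonneg
  · simpa [add_div, sub_div] using div_le_div_of_nonneg_right (hup _ _ (hle n)) n.cast_nonneg

end RenewalTimes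

/-- Environments indexed by column `n : ℕ` and height `y : ℤ`. -/
abbrev Env (S : Type*) : Type _ := ℕ × ℤ → S

/-- The environment seen from the site `(k, y)`. -/
def shift {S : Type*} (k : ℕ) (y : ℤ) (ω : Env S) : Env S := fun i => ω (i.1 + k, i.2 + y)

/-- The heights at which the next column is entered, when the current column has occupation `ξ` and
is itself entered at the heights in `E`. -/
def nextEntry (ξ : ℤ → Bool) (E : Set ℤ) : Set ℤ :=
  {z | ∃ e ∈ E, ∃ y, e ≤ y ∧ (∀ u, e ≤ u → u ≤ y → ξ u = true) ∧ (z = y ∨ z = y + 1)}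

/-- The heights at which column `n` is entered by paths entering column `0` in `A`. -/
def entry (ω : Env Bool) (A : Set ℤ) : ℕ → Set ℤ
  | 0 => A
  | n + 1 => nextEntry (fun y => ω (n, y)) (entry ω A n)

section Deterministic

variable {S : Type*} {ω ω' : Env Bool} {A B : Set ℤ} {n k : ℕ} {y : ℤ}

@[simp] lemma entry_zero : entry ω A 0 = A := rfl

lemma entry_succ : entry ω A (n + 1) = nextEntry (fun y => ω (n, y)) (entry ω A n) := rfl

lemma shift_shift (j k : ℕ) (x y : ℤ) (ω : Env S) :
    shift j x (shift k y ω) = shift (k + j) (y + x) ω := by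
  funext i
  simp only [shift]
  congr 2 <;> ring

@[simp] lemma shift_zero (ω : Env S) : shift 0 0 ω = ω := by
  funext i; simp [shift]

lemma nextEntry_mono {ξ ξ' : ℤ → Bool} (hξ : ∀ y, ξ y = true → ξ' y = true) (h : A ⊆ B) :
    nextEntry ξ A ⊆ nextEntry ξ' B := by
  rintro z ⟨e, he, y, hy, hr, hz⟩
  exact ⟨e, h he, y, hy, fun u h1 h2 => hξ u (hr u h1 h2), hz⟩

lemma entry_mono_env (hω : ∀ i, ω i = true → ω' i = true) (h : A ⊆ B) (n : ℕ) :
    entry ω A n ⊆ entry ω' B n := by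
  induction n with
  | zero => exact h
  | succ n ih => exact nextEntry_mono (fun y => hω (n, y)) ih

lemma entry_mono (h : A ⊆ B) (n : ℕ) : entry ω A n ⊆ entry ω B n :=
  entry_mono_env (fun _ => id) h n

lemma nextEntry_union (ξ : ℤ → Bool) (A B : Set ℤ) :
    nextEntry ξ (A ∪ B) = nextEntry ξ A ∪ nextEntry ξ B := by
  apply Set.Subset.antisymm
  · rintro z ⟨e, he | he, h⟩
    · exact Or.inl ⟨e, he, h⟩
    · exact Or.inr ⟨e, he, h⟩
  · exact Set.union_subset (nextEntry_mono (fun _ => id) Set.subset_union_left)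
      (nextEntry_mono (fun _ => id) Set.subset_union_right)

lemma entry_union (A B : Set ℤ) (n : ℕ) : entry ω (A ∪ B) n = entry ω A n ∪ entry ω B n := by
  induction n with
  | zero => rfl
  | succ n ih => rw [entry_succ, ih, nextEntry_union]; rfl

lemma nextEntry_empty (ξ : ℤ → Bool) : nextEntry ξ ∅ = ∅ := by
  ext z; simp [nextEntry]

lemma entry_empty (n : ℕ) : entry ω ∅ n = ∅ := by
  induction n with
  | zero => rfl
  | succ n ih => rw [entry_succ, ih, nextEntry_empty]

lemma entry_congr (h : ∀ i : ℕ × ℤ, i.1 < n → ω i = ω' i) : entry ω A n = entry ω' A n := by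
  induction n with
  | zero => rfl
  | succ n ih =>
    rw [entry_succ, entry_succ, ih fun i hi => h i (hi.trans n.lt_succ_self)]
    congr 1
    funext y
    exact h (n, y) n.lt_succ_self

lemma entry_add (ω : Env Bool) (A : Set ℤ) (k n : ℕ) :
    entry ω A (k + n) = entry (shift k 0 ω) (entry ω A k) n := by
  induction n with
  | zero => rfl
  | succ n ih =>
    rw [← add_assoc, entry_succ, ih, entry_succ]
    congr 1
    funext y
    simp [shift, add_comm]

lemma nextEntry_translate (ξ : ℤ → Bool) (B : Set ℤ) (y : ℤ) :
    nextEntry (fun u => ξ (u + y)) {a | a + y ∈ B} = {z | z + y ∈ nextEntry ξ B} := by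
  ext z
  constructor
  · rintro ⟨e, he, x, hx, hr, hz⟩
    refine ⟨e + y, he, x + y, by lia, fun u h1 h2 => ?_, by lia⟩
    simpa using hr (u - y) (by lia) (by lia)
  · rintro ⟨e, he, x, hx, hr, hz⟩
    refine ⟨e - y, by simpa using he, x - y, by lia, fun u h1 h2 => ?_, by lia⟩
    exact hr (u + y) (by lia) (by lia)

lemma entry_shift (ω : Env Bool) (B : Set ℤ) (k : ℕ) (y : ℤ) (n : ℕ) :
    entry (shift k y ω) {a | a + y ∈ B} n = {z | z + y ∈ entry (shift k 0 ω) B n} := by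
  induction n with
  | zero => rfl
  | succ n ih =>
    rw [entry_succ, ih, entry_succ, ← nextEntry_translate]
    congr 1
    funext u
    simp [shift]

lemma mem_entry_shift_singleton {z : ℤ} :
    z ∈ entry (shift k y ω) {0} n ↔ z + y ∈ entry (shift k 0 ω) {y} n := by
  have h := entry_shift ω {y} k y n
  have : {a : ℤ | a + y ∈ ({y} : Set ℤ)} = {0} := by ext; simp
  rw [this] at h
  rw [h]; rfl

lemma mem_entry_shift_Iic {z : ℤ} :
    z ∈ entry (shift k y ω) (Set.Iic 0) n ↔ z + y ∈ entry (shift k 0 ω) (Set.Iic y) n := by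
  have h := entry_shift ω (Set.Iic y) k y n
  have : {a : ℤ | a + y ∈ Set.Iic y} = Set.Iic 0 := by ext; simp
  rw [this] at h
  rw [h]; rfl

/-- Every point of `A` lying above some point of `B` belongs to `B`. The relation is preserved by
`nextEntry`, which is how planarity enters the argument. -/
def Covers (A B : Set ℤ) : Prop := ∀ z ∈ A, ∀ z' ∈ B, z' ≤ z → z ∈ B

/- Planarity: a path that starts below and ends above another path meets it. -/
lemma Covers.nextEntry {A B : Set ℤ} (h : Covers A B) (ξ : ℤ → Bool) :
    Covers (nextEntry ξ A) (nextEntry ξ B) := by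
  rintro z ⟨e, he, y, hy, hr, hz⟩ z' ⟨e', he', y', hy', hr', hz'⟩ hle
  by_cases hee : e' ≤ e
  · exact ⟨e, h e he e' he' hee, y, hy, hr, hz⟩
  by_cases hye : e' ≤ y
  · exact ⟨e', he', y, hye, fun u h1 h2 => hr u (by lia) h2, hz⟩
  · have : z = z' := by lia
    subst this
    exact ⟨e', he', y', hy', hr', hz'⟩

lemma Covers.entry {A B : Set ℤ} (h : Covers A B) (ω : Env Bool) (n : ℕ) :
    Covers (entry ω A n) (entry ω B n) := by
  induction n with
  | zero => exact h
  | succ n ih => exact ih.nextEntry _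

lemma covers_Iic_singleton (y : ℤ) : Covers (Set.Iic y) {y} := by
  rintro z hz z' rfl h
  exact le_antisymm hz h

lemma exists_le_of_mem_entry {z : ℤ} (h : z ∈ entry ω A n) : ∃ a ∈ A, a ≤ z := by
  induction n generalizing z with
  | zero => exact ⟨z, h, le_rfl⟩
  | succ n ih =>
    obtain ⟨e, he, y, hy, -, hz⟩ := h
    obtain ⟨a, ha, hae⟩ := ih he
    exact ⟨a, ha, by lia⟩

/-- Each column has vacant sites arbitrarily high up, and arbitrarily low down there are rows
occupied along any given number of columns. -/
def Typical (ω : Env Bool) : Prop :=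
  ∀ n : ℕ, ∀ b : ℤ, (∃ y, b ≤ y ∧ ω (n, y) = false) ∧ ∃ y ≤ b, ∀ i < n, ω (i, y) = true

lemma Typical.comp_shift (h : Typical ω) (k : ℕ) (y : ℤ) : Typical (shift k y ω) := by
  intro n b
  obtain ⟨⟨u, hu, hv⟩, -⟩ := h (n + k) (b + y)
  obtain ⟨-, ⟨u', hu', hv'⟩⟩ := h (n + k) (b + y)
  refine ⟨⟨u - y, by lia, by simpa [shift] using hv⟩, u' - y, by lia, fun i hi => ?_⟩
  simpa [shift] using hv' (i + k) (by lia)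

lemma bddAbove_nextEntry {ξ : ℤ → Bool} (h : ∀ b, ∃ y, b ≤ y ∧ ξ y = false) (hA : BddAbove A) :
    BddAbove (nextEntry ξ A) := by
  obtain ⟨b, hb⟩ := hA
  obtain ⟨v, hv, hξ⟩ := h b
  refine ⟨v, ?_⟩
  rintro z ⟨e, he, y, -, hr, hz⟩
  by_contra hlt
  have := hr v ((hb he).trans hv) (by lia)
  simp [hξ] at this

lemma Typical.bddAbove_entry (h : Typical ω) (hA : BddAbove A) (n : ℕ) :
    BddAbove (entry ω A n) := by
  induction n with
  | zero => exact hA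
  | succ n ih => exact bddAbove_nextEntry (fun b => (h n b).1) ih

lemma mem_entry_of_row_occupied (hy : y ∈ A) (h : ∀ i < n, ω (i, y) = true) : y ∈ entry ω A n := by
  induction n with
  | zero => exact hy
  | succ n ih =>
    refine ⟨y, ih fun i hi => h i (hi.trans n.lt_succ_self), y, le_rfl, fun u h1 h2 => ?_,
      Or.inl rfl⟩
    rw [le_antisymm h2 h1]
    exact h n n.lt_succ_self

/-- The highest entry point into column `n` of the paths started from `{(0, y) : y ≤ 0}`. -/
noncomputable def top (ω : Env Bool) (n : ℕ) : ℤ := sSup (entry ω (Set.Iic 0) n)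

/-- The origin reaches every column. -/
def Survives (ω : Env Bool) : Prop := ∀ n, (entry ω {0} n).Nonempty

/-- The highest entry point into column `k` reaches every later column. -/
def IsRenewal (ω : Env Bool) (k : ℕ) : Prop := Survives (shift k (top ω k) ω)

@[simp] lemma top_zero (ω : Env Bool) : top ω 0 = 0 := by
  simp [top]

lemma isRenewal_zero_iff : IsRenewal ω 0 ↔ Survives ω := by simp [IsRenewal]

lemma Typical.isGreatest_entry_Iic (h : Typical ω) (n : ℕ) :
    IsGreatest (entry ω (Set.Iic 0) n) (top ω n) := by
  obtain ⟨y, hy, hr⟩ := (h n 0).2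
  have hne : (entry ω (Set.Iic 0) n).Nonempty := ⟨y, mem_entry_of_row_occupied hy hr⟩
  have hb := h.bddAbove_entry (A := Set.Iic 0) bddAbove_Iic n
  exact ⟨Int.csSup_mem hne hb, fun z hz => le_csSup hb hz⟩

lemma top_congr (h : ∀ i : ℕ × ℤ, i.1 < n → ω i = ω' i) : top ω n = top ω' n := by
  rw [top, top, entry_congr h]

lemma Typical.top_mem_of_nonempty (h : Typical ω) (hne : (entry ω {0} n).Nonempty) :
    top ω n ∈ entry ω {0} n := by
  obtain ⟨z, hz⟩ := hne
  have hg := h.isGreatest_entry_Iic n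
  exact (covers_Iic_singleton 0).entry ω n _ hg.1 z hz
    (hg.2 (entry_mono (by simp) n hz))

lemma Typical.top_nonneg (h : Typical ω) (hne : (entry ω {0} n).Nonempty) : 0 ≤ top ω n := by
  obtain ⟨a, rfl, h⟩ := exists_le_of_mem_entry (h.top_mem_of_nonempty hne)
  exact h

lemma Typical.top_add_le_of_le (h : Typical ω) {b : ℤ} (hb : top ω k ≤ b) (n : ℕ) :
    top ω (k + n) ≤ b + top (shift k b ω) n := by
  have h1 := (h.isGreatest_entry_Iic (k + n)).1
  rw [entry_add] at h1
  have h2 := entry_mono (ω := shift k 0 ω) (fun z hz => ((h.isGreatest_entry_Iic k).2 hz).trans hb :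
    entry ω (Set.Iic 0) k ⊆ Set.Iic b) n h1
  have h3 : top ω (k + n) - b ∈ entry (shift k b ω) (Set.Iic 0) n :=
    mem_entry_shift_Iic.2 (by rw [sub_add_cancel]; exact h2)
  have := ((h.comp_shift k b).isGreatest_entry_Iic n).2 h3
  lia

lemma Typical.top_add_le (h : Typical ω) (k n : ℕ) :
    top ω (k + n) ≤ top ω k + top (shift k (top ω k) ω) n :=
  h.top_add_le_of_le le_rfl n

lemma Typical.top_add (h : Typical ω) {k n : ℕ}
    (hne : (entry (shift k (top ω k) ω) {0} n).Nonempty) :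
    top ω (k + n) = top ω k + top (shift k (top ω k) ω) n := by
  refine le_antisymm (h.top_add_le k n) ?_
  have h1 := (h.comp_shift k (top ω k)).top_mem_of_nonempty hne
  rw [mem_entry_shift_singleton] at h1
  have h2 : top (shift k (top ω k) ω) n + top ω k ∈ entry ω (Set.Iic 0) (k + n) := by
    rw [entry_add]
    exact entry_mono (by simpa using (h.isGreatest_entry_Iic k).1) n h1
  have := (h.isGreatest_entry_Iic (k + n)).2 h2
  lia

lemma Typical.isRenewal_add_iff (h : Typical ω) {k : ℕ} (hk : IsRenewal ω k) (n : ℕ) :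
    IsRenewal ω (k + n) ↔ IsRenewal (shift k (top ω k) ω) n := by
  rw [IsRenewal, IsRenewal, shift_shift, h.top_add (hk n)]

lemma Typical.top_mono_of_isRenewal (h : Typical ω) (hk : IsRenewal ω k) (hkn : k ≤ n) :
    top ω k ≤ top ω n := by
  obtain ⟨d, rfl⟩ := Nat.exists_eq_add_of_le hkn
  rw [h.top_add (hk d)]
  exact le_add_of_nonneg_right ((h.comp_shift _ _).top_nonneg (hk d))

lemma nonempty_entry_add_of_survives {x : ℤ} (hx : x ∈ entry ω A k)
    (hs : Survives (shift k x ω)) (n : ℕ) : (entry ω A (k + n)).Nonempty := by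
  obtain ⟨z, hz⟩ := hs n
  rw [mem_entry_shift_singleton] at hz
  refine ⟨z + x, ?_⟩
  rw [entry_add]
  exact entry_mono (by simpa using hx) n hz

lemma nonempty_entry_of_le (hkn : k ≤ n) (h : (entry ω A n).Nonempty) :
    (entry ω A k).Nonempty := by
  by_contra hk
  obtain ⟨m, rfl⟩ := Nat.exists_eq_add_of_le hkn
  rw [entry_add, Set.not_nonempty_iff_eq_empty.1 hk, entry_empty] at h
  exact Set.not_nonempty_empty h

lemma Typical.isRenewal_iff_nonempty (h : Typical ω) {j n : ℕ} (hr : IsRenewal ω (j + n)) :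
    IsRenewal ω j ↔ (entry (shift j (top ω j) ω) {0} n).Nonempty := by
  refine ⟨fun hj => hj n, fun hne m => ?_⟩
  have h1 := (h.comp_shift j (top ω j)).top_mem_of_nonempty hne
  have h2 : Survives (shift n (top (shift j (top ω j) ω) n) (shift j (top ω j) ω)) := by
    rw [shift_shift, ← h.top_add hne]
    exact hr
  exact nonempty_entry_of_le (Nat.le_add_left m n) (nonempty_entry_add_of_survives h1 h2 m)

/-- The number of consecutive occupied sites in column `0`, starting from height `0` upwards. -/
noncomputable def run (ω : Env Bool) : ℕ := sInf {k : ℕ | ω (0, (k : ℤ)) = false}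

/-- The number of consecutive occupied sites above the highest entry point into column `n`. -/
noncomputable def topRun (ω : Env Bool) (n : ℕ) : ℕ := run (shift n (top ω n) ω)

lemma Typical.run_spec (h : Typical ω) : ω (0, (run ω : ℤ)) = false := by
  obtain ⟨⟨y, hy, hv⟩, -⟩ := h 0 0
  have : {k : ℕ | ω (0, (k : ℤ)) = false}.Nonempty := ⟨y.toNat, by simpa [Int.toNat_of_nonneg hy]⟩
  exact Nat.sInf_mem this

lemma eq_true_of_lt_run {k : ℕ} (hk : k < run ω) : ω (0, (k : ℤ)) = true := by
  have := Nat.notMem_of_lt_sInf hk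
  simpa using this

lemma Typical.topRun_spec (h : Typical ω) (n : ℕ) : ω (n, top ω n + topRun ω n) = false := by
  have := (h.comp_shift n (top ω n)).run_spec
  simpa [shift, topRun, add_comm] using this

lemma Typical.top_succ_le (h : Typical ω) (n : ℕ) : top ω (n + 1) ≤ top ω n + topRun ω n := by
  obtain ⟨e, he, y, -, hr, hz⟩ := (h.isGreatest_entry_Iic (n + 1)).1
  have h1 := (h.isGreatest_entry_Iic n).2 he
  by_contra hlt
  have := hr (top ω n + topRun ω n) (by lia) (by lia)
  simp [h.topRun_spec] at this

/-- The total length of the runs above the highest entry points. -/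
noncomputable def runSum (ω : Env Bool) (n : ℕ) : ℕ := ∑ j ∈ Finset.range n, topRun ω j

lemma Typical.top_le_add_runSum (h : Typical ω) {m n : ℕ} (hmn : m ≤ n) :
    top ω n + runSum ω m ≤ top ω m + runSum ω n := by
  induction n, hmn using Nat.le_induction with
  | base => exact le_rfl
  | succ n _ ih =>
    have := h.top_succ_le n
    have h2 : runSum ω (n + 1) = runSum ω n + topRun ω n := Finset.sum_range_succ _ _
    push_cast [h2]
    lia

end Deterministic

section Restart

variable {S β : Type*}

/-- The sites in the first `k` columns. -/
def columnsBefore (k : ℕ) : Set (ℕ × ℤ) := {i | i.1 < k}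

lemma columnsBefore_mono {k l : ℕ} (h : k ≤ l) : columnsBefore k ⊆ columnsBefore l :=
  fun _ hi => lt_of_lt_of_le hi h

lemma dependsOn_comp_shift {f : Env S → β} {j k : ℕ} (hf : DependsOn f (columnsBefore k))
    {N : Env S → ℤ} (hN : DependsOn N (columnsBefore j)) :
    DependsOn (fun ω => f (shift j (N ω) ω)) (columnsBefore (j + k)) := by
  intro ω ω' h
  have hNe : N ω = N ω' := hN fun i hi => h i (columnsBefore_mono (Nat.le_add_right j k) hi)
  simp only [hNe]
  refine hf fun i hi => h _ ?_
  simp only [columnsBefore, Set.mem_ofPred_eq] at hi ⊢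
  lia

variable [MeasurableSpace S] [MeasurableSpace β]

@[fun_prop]
lemma measurable_shift (k : ℕ) (y : ℤ) : Measurable (shift (S := S) k y) :=
  measurable_pi_lambda _ fun _ => measurable_pi_apply _

lemma measurable_shift_random (k : Env S → ℕ) (hk : Measurable k) (N : Env S → ℤ)
    (hN : Measurable N) : Measurable fun ω => shift (k ω) (N ω) ω := by
  have h : Measurable fun x : (ℕ × ℤ) × Env S => shift x.1.1 x.1.2 x.2 :=
    measurable_from_prod_countable_right fun c => measurable_shift c.1 c.2
  exact h.comp ((hk.prodMk hN).prodMk measurable_id)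

lemma measurable_iSup_comap_shift (k : ℕ) (y : ℤ) :
    Measurable[⨆ i ∈ (columnsBefore k)ᶜ,
      MeasurableSpace.comap (fun ω : Env S => ω i) inferInstance] (shift (S := S) k y) := by
  refine @measurable_pi_lambda _ _ _ (_) _ _ fun i => ?_
  have hi : (i.1 + k, i.2 + y) ∈ (columnsBefore k)ᶜ := (Nat.le_add_left k i.1).not_gt
  exact (comap_measurable _).mono (le_iSup₂_of_le _ hi le_rfl) le_rfl

variable (ν : Measure S) [IsProbabilityMeasure ν]

/-- The law of an environment whose sites are independent with law `ν`. -/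
noncomputable def envLaw : Measure (Env S) := Measure.infinitePi fun _ : ℕ × ℤ => ν

instance : IsProbabilityMeasure (envLaw ν) := by unfold envLaw; infer_instance

lemma measurePreserving_shift (k : ℕ) (y : ℤ) :
    MeasurePreserving (shift k y) (envLaw ν) (envLaw ν) := by
  refine ⟨measurable_shift k y, ?_⟩
  have hinj : Function.Injective fun i : ℕ × ℤ => (i.1 + k, i.2 + y) := by
    rintro ⟨a, b⟩ ⟨c, d⟩ h
    simpa using h
  exact Measure.map_infinitePi_infinitePi_of_inj (P := fun _ : ℕ × ℤ => ν) hinj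

lemma measure_inter_shift {k : ℕ} {D C : Set (Env S)} (hD : MeasurableSet D)
    (hDk : DependsOn (· ∈ D) (columnsBefore k)) (hC : MeasurableSet C) (y : ℤ) :
    envLaw ν (D ∩ shift k y ⁻¹' C) = envLaw ν D * envLaw ν C := by
  have : Nonempty S := nonempty_of_isProbabilityMeasure ν
  have hind : iIndep (fun i => MeasurableSpace.comap (fun ω : Env S => ω i) inferInstance)
      (envLaw ν) :=
    iIndepFun_infinitePi (P := fun _ : ℕ × ℤ => ν) (X := fun _ s => s) fun _ => measurable_id
  have hindep := indep_iSup_of_disjoint (fun i => (measurable_pi_apply i).comap_le) hind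
    (disjoint_compl_right (a := columnsBefore k))
  rw [(Indep_iff _ _ _).1 hindep _ _ (measurableSet_iSup_comap_of_dependsOn hD hDk)
      (measurable_iSup_comap_shift k y hC),
    (measurePreserving_shift ν k y).measure_preimage hC.nullMeasurableSet]

lemma measure_inter_restart {k : ℕ} {D C : Set (Env S)} (hD : MeasurableSet D)
    (hDk : DependsOn (· ∈ D) (columnsBefore k)) (hC : MeasurableSet C) {N : Env S → ℤ}
    (hN : Measurable N) (hNk : DependsOn N (columnsBefore k)) :
    envLaw ν (D ∩ (fun ω => shift k (N ω) ω) ⁻¹' C) = envLaw ν D * envLaw ν C := by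
  rw [measure_eq_tsum_inter_preimage_singleton _ hN (D ∩ _),
    measure_eq_tsum_inter_preimage_singleton _ hN D, ← ENNReal.tsum_mul_right]
  refine tsum_congr fun y => ?_
  have hdep : DependsOn (· ∈ D ∩ N ⁻¹' {y}) (columnsBefore k) := by
    intro ω ω' h
    simp only [Set.mem_inter_iff, Set.mem_preimage, hNk h]
    rw [show (ω ∈ D) = (ω' ∈ D) from hDk h]
  rw [← measure_inter_shift ν (hD.inter (hN (measurableSet_singleton y))) hdep hC y]
  congr 1
  ext ω
  simp only [Set.mem_inter_iff, Set.mem_preimage, Set.mem_singleton_iff]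
  exact ⟨fun ⟨⟨hωD, hωC⟩, hy⟩ => ⟨⟨hωD, hy⟩, hy ▸ hωC⟩,
    fun ⟨⟨hωD, hy⟩, hωC⟩ => ⟨⟨hωD, hy ▸ hωC⟩, hy⟩⟩

lemma measurePreserving_restart {k : ℕ} {N : Env S → ℤ} (hN : Measurable N)
    (hNk : DependsOn N (columnsBefore k)) :
    MeasurePreserving (fun ω => shift k (N ω) ω) (envLaw ν) (envLaw ν) := by
  have hmeas := measurable_shift_random (fun _ => k) measurable_const N hN
  refine ⟨hmeas, Measure.ext fun C hC => ?_⟩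
  have h := measure_inter_restart ν (k := k) MeasurableSet.univ (fun _ _ _ => by simp) hC hN hNk
  rw [Measure.map_apply hmeas hC]
  simpa using h

lemma indepFun_restart {k : ℕ} {N : Env S → ℤ} (hN : Measurable N)
    (hNk : DependsOn N (columnsBefore k)) {X : Env S → β} (hX : Measurable X)
    (hXk : DependsOn X (columnsBefore k)) :
    IndepFun X (fun ω => shift k (N ω) ω) (envLaw ν) := by
  rw [indepFun_iff_measure_inter_preimage_eq_mul]
  intro s t hs ht
  rw [(measurePreserving_restart ν hN hNk).measure_preimage ht.nullMeasurableSet]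
  refine measure_inter_restart ν (hX hs) (fun ω ω' h => ?_) ht hN hNk
  simp only [Set.mem_preimage, hXk h]

end Restart

section Measurability

lemma measurable_eq_true (i : ℕ × ℤ) : Measurable fun ω : Env Bool => ω i = true :=
  Measurable.eq_const (f := fun ω : Env Bool => ω i) (measurable_pi_apply i) true

lemma measurable_mem_entry (A : Set ℤ) (n : ℕ) (z : ℤ) :
    Measurable fun ω : Env Bool => z ∈ entry ω A n := by
  induction n generalizing z with
  | zero => exact measurable_const
  | succ n ih =>
    change Measurable fun ω : Env Bool => ∃ e, e ∈ entry ω A n ∧ ∃ y, e ≤ y ∧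
      (∀ u, e ≤ u → u ≤ y → ω (n, u) = true) ∧ (z = y ∨ z = y + 1)
    refine Measurable.exists fun e => (ih e).and (Measurable.exists fun y =>
      measurable_const.and (Measurable.and ?_ measurable_const))
    exact Measurable.forall fun u => measurable_const.imp (measurable_const.imp
      (measurable_eq_true (n, u)))

lemma measurable_nonempty_entry (A : Set ℤ) (n : ℕ) :
    Measurable fun ω : Env Bool => (entry ω A n).Nonempty :=
  Measurable.exists fun z => measurable_mem_entry A n z

lemma measurable_top (n : ℕ) : Measurable fun ω : Env Bool => top ω n :=
  measurable_int_sSup fun z => measurable_mem_entry (Set.Iic 0) n z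

lemma dependsOn_top (n : ℕ) : DependsOn (fun ω : Env Bool => top ω n) (columnsBefore n) :=
  fun _ _ h => top_congr h

lemma measurable_survives : Measurable Survives :=
  Measurable.forall fun n => measurable_nonempty_entry {0} n

lemma measurableSet_survives : MeasurableSet {ω | Survives ω} :=
  measurableSet_setOfPred.2 measurable_survives

/-- The environment seen from the highest entry point into column `k`. -/
noncomputable def fromTop (k : ℕ) (ω : Env Bool) : Env Bool := shift k (top ω k) ω

lemma measurable_fromTop (k : ℕ) : Measurable (fromTop k) :=
  measurable_shift_random (fun _ => k) measurable_const _ (measurable_top k)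

lemma measurable_isRenewal (k : ℕ) : Measurable fun ω => IsRenewal ω k :=
  measurable_survives.comp (measurable_fromTop k)

lemma measurable_eq_false (i : ℕ × ℤ) : Measurable fun ω : Env Bool => ω i = false :=
  Measurable.eq_const (f := fun ω : Env Bool => ω i) (measurable_pi_apply i) false

lemma measurable_run : Measurable run := measurable_nat_sInf fun _ => measurable_eq_false _

lemma dependsOn_run : DependsOn run (columnsBefore 1) := by
  intro ω ω' h
  have : ∀ k : ℕ, ω (0, (k : ℤ)) = ω' (0, (k : ℤ)) := fun k => h _ Nat.zero_lt_one
  simp [run, this]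

lemma measurable_topRun (n : ℕ) : Measurable fun ω => topRun ω n :=
  measurable_run.comp (measurable_fromTop n)

lemma dependsOn_topRun (n : ℕ) : DependsOn (fun ω => topRun ω n) (columnsBefore (n + 1)) :=
  dependsOn_comp_shift dependsOn_run (dependsOn_top n)

lemma measurable_runSum (n : ℕ) : Measurable fun ω => runSum ω n :=
  Finset.measurable_sum _ fun j _ => measurable_topRun j

lemma dependsOn_runSum (n : ℕ) : DependsOn (fun ω => runSum ω n) (columnsBefore n) := by
  intro ω ω' h
  refine Finset.sum_congr rfl fun j hj => dependsOn_topRun j fun i hi => h i ?_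
  exact columnsBefore_mono (Finset.mem_range.1 hj) hi

end Measurability

section Tails

/-- The law of the percolation environment with density `p`. -/
noncomputable abbrev percLaw (p : unitInterval) : Measure (Env Bool) :=
  envLaw (bernoulliMeasure true false p)

variable (p : unitInterval)

lemma percLaw_column (n m : ℕ) (b : ℤ) :
    percLaw p {ω | ∀ k < m, ω (n, b + (k : ℤ)) = true} =
      (unitInterval.toNNReal p : ENNReal) ^ m := by
  have hinj : Function.Injective fun k : ℕ => ((n, b + (k : ℤ)) : ℕ × ℤ) := by
    intro a c h; simpa using h
  have hs : {ω : Env Bool | ∀ k < m, ω (n, b + (k : ℤ)) = true} =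
      Set.pi ((Finset.range m).map ⟨_, hinj⟩) fun _ => {true} := by
    ext ω; simp [Set.mem_pi]
  rw [hs, percLaw, envLaw, Measure.infinitePi_pi _ fun _ _ => measurableSet_singleton _]
  simp

lemma percLaw_rows (n m : ℕ) (b : ℤ) :
    percLaw p {ω | ∀ k < m, ¬ ∀ i < n, ω (i, b - (k : ℤ)) = true} =
      (1 - (unitInterval.toNNReal p : ENNReal) ^ n) ^ m := by
  have hinj : Function.Injective fun x : ℕ × ℕ => (x.2, b - (x.1 : ℤ)) := by
    rintro ⟨a, c⟩ ⟨a', c'⟩ h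
    simp only [Prod.mk.injEq] at h ⊢
    lia
  have hrow : {r : ℕ → Bool | ∀ i < n, r i = true} = Set.pi (Finset.range n) fun _ => {true} := by
    ext r; simp [Set.mem_pi]
  have hmeas : MeasurableSet {r : ℕ → Bool | ∀ i < n, r i = true} := by
    rw [hrow]
    exact MeasurableSet.pi (Finset.countable_toSet _) fun _ _ => measurableSet_singleton _
  have h := infinitePi_forall_row_mem (bernoulliMeasure true false p) hinj hmeas.compl m
  rw [prob_compl_eq_one_sub hmeas, hrow,
    Measure.infinitePi_pi _ fun _ _ => measurableSet_singleton _, ← hrow] at h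
  simpa [percLaw, envLaw] using h

variable {p}

lemma toNNReal_lt_one (hp : p < 1) : (unitInterval.toNNReal p : ENNReal) < 1 := by
  exact_mod_cast hp

lemma toNNReal_pos (hp : 0 < p) : 0 < (unitInterval.toNNReal p : ENNReal) := by
  exact_mod_cast hp

lemma one_sub_toNNReal_pow_lt_one (hp : 0 < p) (n : ℕ) :
    1 - (unitInterval.toNNReal p : ENNReal) ^ n < 1 :=
  ENNReal.sub_lt_self (by simp) (by simp) (pow_ne_zero n (toNNReal_pos hp).ne')

lemma ae_typical (hp0 : 0 < p) (hp1 : p < 1) : ∀ᵐ ω ∂percLaw p, Typical ω := by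
  refine ae_all_iff.2 fun n => ae_all_iff.2 fun b => Filter.Eventually.and ?_ ?_
  · rw [ae_iff]
    refine measure_eq_zero_of_le_pow (toNNReal_lt_one hp1) fun m => ?_
    rw [← percLaw_column p n m b]
    refine measure_mono fun ω hω k _ => ?_
    by_contra h
    exact hω ⟨b + k, by lia, by simpa using h⟩
  · rw [ae_iff]
    refine measure_eq_zero_of_le_pow (one_sub_toNNReal_pow_lt_one hp0 n) fun m => ?_
    rw [← percLaw_rows p n m b]
    refine measure_mono fun ω hω k _ h => ?_
    exact hω ⟨b - k, by lia, h⟩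

lemma integrable_run (hp1 : p < 1) : Integrable (fun ω => (run ω : ℝ)) (percLaw p) := by
  refine integrable_natCast_of_le_pow measurable_run (toNNReal_lt_one hp1) fun m => ?_
  rw [← percLaw_column p 0 m 0]
  refine measure_mono fun ω hω k hk => ?_
  have : m < run ω := hω
  rw [zero_add]
  exact eq_true_of_lt_run (hk.trans this)

variable (p) in
lemma measurePreserving_fromTop (k : ℕ) :
    MeasurePreserving (fromTop k) (percLaw p) (percLaw p) :=
  measurePreserving_restart _ (measurable_top k) (dependsOn_top k)

lemma integrable_topRun (hp1 : p < 1) (n : ℕ) :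
    Integrable (fun ω => (topRun ω n : ℝ)) (percLaw p) :=
  (measurePreserving_fromTop p n).integrable_comp_of_integrable (integrable_run hp1)

lemma integrable_runSum (hp1 : p < 1) (n : ℕ) :
    Integrable (fun ω => (runSum ω n : ℝ)) (percLaw p) := by
  simp only [runSum, Nat.cast_sum]
  exact integrable_finsetSum _ fun j _ => integrable_topRun hp1 j

lemma integral_runSum (hp1 : p < 1) (n : ℕ) :
    ∫ ω, (runSum ω n : ℝ) ∂percLaw p = n * ∫ ω, (run ω : ℝ) ∂percLaw p := by
  have h : ∀ j, ∫ ω, (topRun ω j : ℝ) ∂percLaw p = ∫ ω, (run ω : ℝ) ∂percLaw p := fun j =>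
    integral_comp_measurePreserving (measurePreserving_fromTop p j)
      (measurable_from_top.comp measurable_run : Measurable fun ω => (run ω : ℝ))
  simp only [runSum, Nat.cast_sum]
  rw [integral_finsetSum _ fun j _ => integrable_topRun hp1 j]
  simp [h]

/-- The depth of the first row at height at most `0` that is occupied along `n` columns. -/
noncomputable def rowDepth (n : ℕ) (ω : Env Bool) : ℕ :=
  sInf {k : ℕ | ∀ i < n, ω (i, -(k : ℤ)) = true}

lemma Typical.neg_rowDepth_le_top {ω : Env Bool} (h : Typical ω) (n : ℕ) :
    -(rowDepth n ω : ℤ) ≤ top ω n := by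
  obtain ⟨y, hy, hr⟩ := (h n 0).2
  have hne : {k : ℕ | ∀ i < n, ω (i, -(k : ℤ)) = true}.Nonempty := by
    refine ⟨(-y).toNat, fun i hi => ?_⟩
    rw [Int.toNat_of_nonneg (by lia), neg_neg]
    exact hr i hi
  have hm : ∀ i < n, ω (i, -(rowDepth n ω : ℤ)) = true := Nat.sInf_mem hne
  exact (h.isGreatest_entry_Iic n).2 (mem_entry_of_row_occupied (by simp) hm)

lemma integrable_rowDepth (hp0 : 0 < p) (n : ℕ) :
    Integrable (fun ω => (rowDepth n ω : ℝ)) (percLaw p) := by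
  refine integrable_natCast_of_le_pow (measurable_nat_sInf fun k => ?_)
    (one_sub_toNNReal_pow_lt_one hp0 n) fun m => ?_
  · exact Measurable.forall fun i => measurable_const.imp (measurable_eq_true _)
  · rw [← percLaw_rows p n m 0]
    refine measure_mono fun ω hω k hk => ?_
    have h1 : m < rowDepth n ω := hω
    rw [zero_sub]
    exact Nat.notMem_of_lt_sInf (hk.trans h1)

lemma Typical.top_le_runSum {ω : Env Bool} (h : Typical ω) (n : ℕ) : top ω n ≤ runSum ω n := by
  simpa [runSum] using h.top_le_add_runSum (Nat.zero_le n)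

lemma measurable_top_real (n : ℕ) : Measurable fun ω : Env Bool => (top ω n : ℝ) :=
  measurable_from_top.comp (measurable_top n)

lemma integrable_top (hp0 : 0 < p) (hp1 : p < 1) (n : ℕ) :
    Integrable (fun ω => (top ω n : ℝ)) (percLaw p) := by
  refine ((integrable_runSum hp1 n).add (integrable_rowDepth hp0 n)).mono'
    (measurable_top_real n).aestronglyMeasurable ?_
  filter_upwards [ae_typical hp0 hp1] with ω hω
  have hlow : -(rowDepth n ω : ℝ) ≤ top ω n := by exact_mod_cast hω.neg_rowDepth_le_top n
  have hupp : (top ω n : ℝ) ≤ runSum ω n := by exact_mod_cast hω.top_le_runSum n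
  rw [Real.norm_eq_abs, abs_le, Pi.add_apply]
  constructor <;> linarith [(rowDepth n ω).cast_nonneg (α := ℝ), (runSum ω n).cast_nonneg (α := ℝ)]

end Tails

section LawOfLargeNumbers

lemma strong_law_fromTop (p : unitInterval) {k : ℕ} {f : Env Bool → ℝ} (hf : Measurable f)
    (hfk : DependsOn f (columnsBefore k)) (hint : Integrable f (percLaw p)) :
    ∀ᵐ ω ∂percLaw p, Tendsto (fun n : ℕ => (∑ i ∈ Finset.range n, f (fromTop (i * k) ω)) / n)
      atTop (𝓝 (∫ ω, f ω ∂percLaw p)) := by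
  refine strong_law_comp_measurePreserving (fun i => measurePreserving_fromTop p (i * k)) hf
    (fun i j hij => ?_) hint
  have hle : i * k + k ≤ j * k := by
    rw [← Nat.succ_mul]
    exact Nat.mul_le_mul_right k hij
  have hdep : DependsOn (fun ω => f (fromTop (i * k) ω)) (columnsBefore (j * k)) :=
    (dependsOn_comp_shift hfk (dependsOn_top (i * k))).mono (columnsBefore_mono hle)
  exact (indepFun_restart _ (measurable_top (j * k)) (dependsOn_top (j * k))
    (hf.comp (measurable_fromTop (i * k))) hdep).comp measurable_id hf

lemma tendsto_runSum {p : unitInterval} (hp1 : p < 1) :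
    ∀ᵐ ω ∂percLaw p, Tendsto (fun n : ℕ => (runSum ω n : ℝ) / n) atTop
      (𝓝 (∫ ω, (run ω : ℝ) ∂percLaw p)) := by
  have h := strong_law_fromTop p (k := 1) (f := fun ω => (run ω : ℝ))
    (measurable_from_top.comp measurable_run)
    (fun _ _ h => by simp only [dependsOn_run h]) (integrable_run hp1)
  filter_upwards [h] with ω hω
  refine hω.congr fun n => ?_
  simp [runSum, topRun, fromTop]

end LawOfLargeNumbers

section Renewals

/-- The first column after column `0` at which the highest entry point reaches all columns. -/
noncomputable def gap (ω : Env Bool) : ℕ := sInf {n | 1 ≤ n ∧ IsRenewal ω n}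

/-- The height of the highest entry point at the first renewal. -/
noncomputable def rise (ω : Env Bool) : ℤ := top ω (gap ω)

/-- The environment seen from the first renewal point. -/
noncomputable def renew (ω : Env Bool) : Env Bool := shift (gap ω) (rise ω) ω

lemma measurable_gap : Measurable gap :=
  measurable_nat_sInf fun n => measurable_const.and (measurable_isRenewal n)

lemma measurable_rise : Measurable rise := by
  have h : Measurable fun x : ℕ × Env Bool => top x.2 x.1 :=
    measurable_from_prod_countable_right fun n => measurable_top n
  exact h.comp (measurable_gap.prodMk measurable_id)

lemma measurable_renew : Measurable renew :=
  measurable_shift_random _ measurable_gap _ measurable_rise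

/-- The origin survives and there is no renewal in the columns `1, …, m`. -/
def NoRenewal (m : ℕ) (ω : Env Bool) : Prop := Survives ω ∧ ∀ i, 1 ≤ i → i ≤ m → ¬ IsRenewal ω i

lemma measurable_noRenewal (m : ℕ) : Measurable (NoRenewal m) :=
  measurable_survives.and (Measurable.forall fun i => measurable_const.imp (measurable_const.imp
    (measurable_isRenewal i).not))

variable {p : unitInterval}

lemma Typical.noRenewal_fromTop_iff {ω : Env Bool} (h : Typical ω) (j m : ℕ) :
    NoRenewal m (fromTop j ω) ↔
      IsRenewal ω j ∧ ∀ i, j < i → i ≤ j + m → ¬ IsRenewal ω i := by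
  refine and_congr_right fun hj => ⟨fun hno i hji him hr => ?_, fun hno i hi him hr => ?_⟩
  · obtain ⟨d, rfl⟩ := Nat.exists_eq_add_of_lt hji
    rw [add_assoc, h.isRenewal_add_iff hj] at hr
    exact hno (d + 1) (by lia) (by lia) hr
  · exact hno (j + i) (by lia) (by lia) ((h.isRenewal_add_iff hj i).2 hr)

/- The summand with index `m` is the probability that the last renewal before a given column `n > m`
happens in column `n - 1 - m`, and these events are disjoint. -/
lemma tsum_noRenewal_le_one (hp0 : 0 < p) (hp1 : p < 1) :
    ∑' m : ℕ, percLaw p {ω | NoRenewal m ω} ≤ 1 := by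
  refine ENNReal.tsum_le_of_sum_range_le fun n => ?_
  let lastAt : ℕ → Set (Env Bool) :=
    fun j => {ω | IsRenewal ω j ∧ ∀ i, j < i → i < n → ¬ IsRenewal ω i}
  have hlastAt : ∀ j, MeasurableSet (lastAt j) := fun j => measurableSet_setOfPred.2
    ((measurable_isRenewal j).and (Measurable.forall fun i => measurable_const.imp
      (measurable_const.imp (measurable_isRenewal i).not)))
  have hmeasure : ∀ j ∈ Finset.range n,
      percLaw p {ω | NoRenewal (n - 1 - j) ω} = percLaw p (lastAt j) := by
    intro j hj
    rw [Finset.mem_range] at hj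
    rw [← (measurePreserving_fromTop p j).measure_preimage
      (measurableSet_setOfPred.2 (measurable_noRenewal _)).nullMeasurableSet]
    refine measure_congr ?_
    filter_upwards [ae_typical hp0 hp1] with ω hω
    have hlt : ∀ i, i ≤ j + (n - 1 - j) ↔ i < n := fun i => by lia
    have hiff := hω.noRenewal_fromTop_iff j (n - 1 - j)
    simp only [hlt] at hiff
    exact propext hiff
  have hdisj : Set.PairwiseDisjoint (Finset.range n : Set ℕ) lastAt := by
    intro i hi j hj hij
    rw [Function.onFun, Set.disjoint_left]
    intro ω h1 h2
    rw [Finset.coe_range, Set.mem_Iio] at hi hj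
    rcases lt_or_gt_of_ne hij with h | h
    · exact h1.2 j h hj h2.1
    · exact h2.2 i h hi h1.1
  rw [← Finset.sum_range_reflect, Finset.sum_congr rfl hmeasure,
    ← measure_biUnion_finset hdisj fun j _ => hlastAt j]
  exact prob_le_one

lemma ae_gap_spec (hp0 : 0 < p) (hp1 : p < 1) :
    ∀ᵐ ω ∂percLaw p, Survives ω → 1 ≤ gap ω ∧ IsRenewal ω (gap ω) := by
  have h0 : Tendsto (fun m => percLaw p {ω | NoRenewal m ω}) atTop (𝓝 0) :=
    ENNReal.tendsto_atTop_zero_of_tsum_ne_top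
      ((tsum_noRenewal_le_one hp0 hp1).trans_lt ENNReal.one_lt_top).ne
  rw [ae_iff]
  refine le_antisymm (ge_of_tendsto' h0 fun m => measure_mono fun ω hω => ?_) zero_le
  simp only [Set.mem_ofPred_eq, Classical.not_imp] at hω
  refine ⟨hω.1, fun i hi _ hr => hω.2 ?_⟩
  exact Nat.sInf_mem (s := {n | 1 ≤ n ∧ IsRenewal ω n}) ⟨i, hi, hr⟩

/-- The part of the first renewal event that is determined by the columns before it. -/
def Past (s : ℕ) (y : ℤ) (ω : Env Bool) : Prop :=
  (entry ω {0} s).Nonempty ∧ top ω s = y ∧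
    ∀ j, 1 ≤ j → j < s → ¬ (entry (fromTop j ω) {0} (s - j)).Nonempty

lemma measurable_past (s : ℕ) (y : ℤ) : Measurable (Past s y) :=
  (measurable_nonempty_entry {0} s).and (((measurable_top s).eq_const y).and
    (Measurable.forall fun j => measurable_const.imp (measurable_const.imp
      ((measurable_nonempty_entry {0} (s - j)).comp (measurable_fromTop j)).not)))

lemma dependsOn_past (s : ℕ) (y : ℤ) : DependsOn (Past s y) (columnsBefore s) := by
  intro ω ω' h
  have hentry : entry ω {0} s = entry ω' {0} s := entry_congr h
  have htop : top ω s = top ω' s := top_congr h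
  have hfrom : ∀ j < s, entry (fromTop j ω) {0} (s - j) = entry (fromTop j ω') {0} (s - j) := by
    intro j hj
    have hdep := dependsOn_comp_shift (f := fun ω => entry ω {0} (s - j)) (k := s - j) (j := j)
      (fun _ _ h => entry_congr h) (dependsOn_top j)
    exact hdep fun i hi => h i (columnsBefore_mono (by lia) hi)
  simp only [Past, hentry, htop]
  congr! 6 with j - hj
  rw [hfrom j hj]

lemma Typical.survives_and_gap_rise_iff {ω : Env Bool} (h : Typical ω)
    (hg : Survives ω → 1 ≤ gap ω ∧ IsRenewal ω (gap ω)) {s : ℕ} (hs : 1 ≤ s) {y : ℤ}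
    {C : Set (Env Bool)} :
    (Survives ω ∧ (gap ω = s ∧ rise ω = y) ∧ renew ω ∈ C) ↔
      Past s y ω ∧ Survives (fromTop s ω) ∧ fromTop s ω ∈ C := by
  have hpast : ∀ j, j ≤ s → IsRenewal ω s →
      (IsRenewal ω j ↔ (entry (fromTop j ω) {0} (s - j)).Nonempty) := by
    intro j hj hr
    obtain ⟨d, rfl⟩ := Nat.exists_eq_add_of_le hj
    rw [Nat.add_sub_cancel_left]
    exact h.isRenewal_iff_nonempty hr
  have h0 : fromTop 0 ω = ω := by simp [fromTop]
  constructor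
  · rintro ⟨hsurv, ⟨rfl, rfl⟩, hC⟩
    obtain ⟨-, hr⟩ := hg hsurv
    refine ⟨⟨hsurv _, rfl, fun j hj1 hj2 hne => ?_⟩, hr, hC⟩
    exact Nat.notMem_of_lt_sInf hj2 ⟨hj1, (hpast j hj2.le hr).2 hne⟩
  · rintro ⟨⟨hne, rfl, hno⟩, hr, hC⟩
    have hsurv : Survives ω :=
      isRenewal_zero_iff.1 ((hpast 0 (Nat.zero_le s) hr).2 (by simpa [h0] using hne))
    have hgap : gap ω = s := by
      refine le_antisymm (Nat.sInf_le ⟨hs, hr⟩) ?_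
      by_contra hlt
      obtain ⟨h1, h2⟩ := hg hsurv
      exact hno _ h1 (not_le.1 hlt) ((hpast _ (not_le.1 hlt).le hr).1 h2)
    refine ⟨hsurv, ⟨hgap, by rw [rise, hgap]⟩, ?_⟩
    rw [renew, rise, hgap]
    exact hC

/-- The law of the environment conditioned on the survival of the origin. -/
noncomputable def survivalLaw (p : unitInterval) : Measure (Env Bool) :=
  ProbabilityTheory.cond (percLaw p) {ω | Survives ω}

lemma survivalLaw_apply (s : Set (Env Bool)) :
    survivalLaw p s = (percLaw p {ω | Survives ω})⁻¹ * percLaw p ({ω | Survives ω} ∩ s) := by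
  rw [survivalLaw, cond_apply measurableSet_survives]

lemma ae_survivalLaw {P : Env Bool → Prop} (h : ∀ᵐ ω ∂percLaw p, Survives ω → P ω) :
    ∀ᵐ ω ∂survivalLaw p, P ω := by
  refine Measure.ae_smul_measure ?_ _
  exact (ae_restrict_iff' measurableSet_survives).2 h

lemma ae_of_ae_survivalLaw {P : Env Bool → Prop} (h : ∀ᵐ ω ∂survivalLaw p, P ω) :
    ∀ᵐ ω ∂percLaw p, Survives ω → P ω := by
  refine (ae_restrict_iff' measurableSet_survives).1 ?_
  rwa [survivalLaw, ProbabilityTheory.cond, Measure.ae_ennreal_smul_measure_iff (by simp)] at h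

lemma isProbabilityMeasure_survivalLaw (hθ : percLaw p {ω | Survives ω} ≠ 0) :
    IsProbabilityMeasure (survivalLaw p) := cond_isProbabilityMeasure hθ

lemma percLaw_survives_inter_gap_rise (hp0 : 0 < p) (hp1 : p < 1) {s : ℕ} (hs : 1 ≤ s) (y : ℤ)
    {C : Set (Env Bool)} (hC : MeasurableSet C) :
    percLaw p ({ω | Survives ω} ∩ ((fun ω => (gap ω, rise ω)) ⁻¹' {(s, y)} ∩ renew ⁻¹' C)) =
      percLaw p {ω | Past s y ω} * percLaw p ({ω | Survives ω} ∩ C) := by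
  rw [← measure_inter_restart _ (measurableSet_setOfPred.2 (measurable_past s y))
    (dependsOn_past s y) (measurableSet_survives.inter hC) (measurable_top s) (dependsOn_top s)]
  refine measure_congr ?_
  filter_upwards [ae_typical hp0 hp1, ae_gap_spec hp0 hp1] with ω hω hg
  refine propext (Iff.trans ?_ (hω.survives_and_gap_rise_iff hg hs (y := y) (C := C)))
  exact and_congr Iff.rfl (and_congr Prod.mk_inj Iff.rfl)

lemma survivalLaw_gap_eq_zero (hp0 : 0 < p) (hp1 : p < 1) :
    survivalLaw p {ω | gap ω = 0} = 0 := by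
  refine measure_eq_zero_iff_ae_notMem.2 (ae_survivalLaw ?_)
  filter_upwards [ae_gap_spec hp0 hp1] with ω hω hsurv
  exact Nat.one_le_iff_ne_zero.1 (hω hsurv).1

lemma survivalLaw_gap_rise_inter_renew (hp0 : 0 < p) (hp1 : p < 1)
    (hθ : percLaw p {ω | Survives ω} ≠ 0) (a : ℕ × ℤ) {C : Set (Env Bool)} (hC : MeasurableSet C) :
    survivalLaw p ((fun ω => (gap ω, rise ω)) ⁻¹' {a} ∩ renew ⁻¹' C) =
      survivalLaw p ((fun ω => (gap ω, rise ω)) ⁻¹' {a}) * survivalLaw p C := by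
  obtain ⟨s, y⟩ := a
  rcases Nat.eq_zero_or_pos s with rfl | hs
  · have hnull : survivalLaw p ((fun ω => (gap ω, rise ω)) ⁻¹' {(0, y)}) = 0 :=
      measure_mono_null (fun ω hω => congrArg Prod.fst hω) (survivalLaw_gap_eq_zero hp0 hp1)
    rw [hnull, zero_mul]
    exact measure_mono_null Set.inter_subset_left hnull
  · have hpast := percLaw_survives_inter_gap_rise hp0 hp1 hs y MeasurableSet.univ
    rw [Set.preimage_univ, Set.inter_univ, Set.inter_univ] at hpast
    rw [survivalLaw_apply, percLaw_survives_inter_gap_rise hp0 hp1 hs y hC, survivalLaw_apply,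
      hpast, survivalLaw_apply]
    calc (percLaw p {ω | Survives ω})⁻¹ *
          (percLaw p {ω | Past s y ω} * percLaw p ({ω | Survives ω} ∩ C))
      _ = (percLaw p {ω | Survives ω})⁻¹ *
          (percLaw p {ω | Past s y ω} * percLaw p ({ω | Survives ω} ∩ C)) *
          ((percLaw p {ω | Survives ω})⁻¹ * percLaw p {ω | Survives ω}) := by
        rw [ENNReal.inv_mul_cancel hθ (measure_ne_top _ _), mul_one]
      _ = _ := by ring

lemma measurePreserving_renew (hp0 : 0 < p) (hp1 : p < 1)
    (hθ : percLaw p {ω | Survives ω} ≠ 0) :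
    MeasurePreserving renew (survivalLaw p) (survivalLaw p) := by
  have := isProbabilityMeasure_survivalLaw hθ
  exact measurePreserving_of_singleton (measurable_gap.prodMk measurable_rise)
    measurable_renew fun a _ hC => survivalLaw_gap_rise_inter_renew hp0 hp1 hθ a hC

lemma indepFun_gap_rise_renew (hp0 : 0 < p) (hp1 : p < 1)
    (hθ : percLaw p {ω | Survives ω} ≠ 0) :
    IndepFun (fun ω => (gap ω, rise ω)) renew (survivalLaw p) := by
  have := isProbabilityMeasure_survivalLaw hθ
  exact indepFun_of_singleton (measurable_gap.prodMk measurable_rise)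
    measurable_renew fun a _ hC => survivalLaw_gap_rise_inter_renew hp0 hp1 hθ a hC

lemma integrable_gap (hp0 : 0 < p) (hp1 : p < 1) (hθ : percLaw p {ω | Survives ω} ≠ 0) :
    Integrable (fun ω => (gap ω : ℝ)) (survivalLaw p) := by
  refine integrable_natCast_of_tsum_lt_top measurable_gap ?_
  have hle : ∀ m, survivalLaw p {ω | m < gap ω} ≤
      (percLaw p {ω | Survives ω})⁻¹ * percLaw p {ω | NoRenewal m ω} := by
    intro m
    rw [survivalLaw_apply]
    gcongr
    rintro ω ⟨h1, h2⟩
    refine ⟨h1, fun i hi him hr => ?_⟩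
    exact Nat.notMem_of_lt_sInf (him.trans_lt h2) ⟨hi, hr⟩
  refine (ENNReal.tsum_le_tsum hle).trans_lt ?_
  rw [ENNReal.tsum_mul_left]
  exact ENNReal.mul_lt_top (by simpa [pos_iff_ne_zero] using hθ)
    ((tsum_noRenewal_le_one hp0 hp1).trans_lt ENNReal.one_lt_top)

/-- The column of the `k`-th renewal. -/
noncomputable def renewalTime (ω : Env Bool) (k : ℕ) : ℕ :=
  ∑ i ∈ Finset.range k, gap (renew^[i] ω)

lemma iterate_renew {ω : Env Bool} (h : Typical ω)
    (hg : ∀ i, Survives (renew^[i] ω)) (k : ℕ) :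
    renew^[k] ω = fromTop (renewalTime ω k) ω ∧
      top ω (renewalTime ω k) = ∑ i ∈ Finset.range k, rise (renew^[i] ω) := by
  induction k with
  | zero => simp [renewalTime, fromTop]
  | succ k ih =>
    obtain ⟨h1, h2⟩ := ih
    have hT : renewalTime ω (k + 1) = renewalTime ω k + gap (renew^[k] ω) :=
      Finset.sum_range_succ _ _
    have hs : (entry (shift (renewalTime ω k) (top ω (renewalTime ω k)) ω) {0}
        (gap (renew^[k] ω))).Nonempty := by
      have := hg k
      rw [h1] at this
      rw [h1]
      exact this _
    have htop : top ω (renewalTime ω (k + 1)) = top ω (renewalTime ω k) + rise (renew^[k] ω) := by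
      rw [hT, h.top_add hs, rise]
      congr 2
      exact h1.symm
    refine ⟨?_, by rw [htop, h2, Finset.sum_range_succ]⟩
    rw [Function.iterate_succ_apply', renew, fromTop, htop, hT]
    conv_lhs => rw [h1]
    rw [fromTop, shift_shift, ← fromTop, ← h1]

lemma ae_iterate_renew (hp0 : 0 < p) (hp1 : p < 1) (hθ : percLaw p {ω | Survives ω} ≠ 0) :
    ∀ᵐ ω ∂survivalLaw p, Typical ω ∧ ∀ i, Survives (renew^[i] ω) ∧ 1 ≤ gap (renew^[i] ω) ∧
      0 ≤ rise (renew^[i] ω) := by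
  have hfirst : ∀ᵐ ω ∂survivalLaw p, Typical ω ∧ Survives ω ∧ 1 ≤ gap ω ∧ 0 ≤ rise ω := by
    refine ae_survivalLaw ?_
    filter_upwards [ae_typical hp0 hp1, ae_gap_spec hp0 hp1] with ω hω hgap hsurv
    exact ⟨hω, hsurv, (hgap hsurv).1, hω.top_nonneg (hsurv _)⟩
  have hiter : ∀ i, ∀ᵐ ω ∂survivalLaw p, Typical (renew^[i] ω) ∧ Survives (renew^[i] ω) ∧
      1 ≤ gap (renew^[i] ω) ∧ 0 ≤ rise (renew^[i] ω) := fun i =>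
    ((measurePreserving_renew hp0 hp1 hθ).iterate i).quasiMeasurePreserving.ae hfirst
  filter_upwards [hfirst, ae_all_iff.2 hiter] with ω hω hωi
  exact ⟨hω.1, fun i => (hωi i).2⟩

lemma strong_law_renew (hp0 : 0 < p) (hp1 : p < 1) (hθ : percLaw p {ω | Survives ω} ≠ 0)
    (f : ℕ × ℤ → ℝ) (hf : Integrable (fun ω => f (gap ω, rise ω)) (survivalLaw p)) :
    ∀ᵐ ω ∂survivalLaw p, Tendsto (fun n : ℕ => (∑ i ∈ Finset.range n,
      f (gap (renew^[i] ω), rise (renew^[i] ω))) / n) atTop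
      (𝓝 (∫ ω, f (gap ω, rise ω) ∂survivalLaw p)) := by
  have hfm : Measurable f := measurable_of_countable f
  exact strong_law_iterate (measurePreserving_renew hp0 hp1 hθ)
    (hfm.comp (measurable_gap.prodMk measurable_rise))
    ((indepFun_gap_rise_renew hp0 hp1 hθ).comp hfm measurable_id) hf

end Renewals

section Slope

variable {p : unitInterval}

lemma strictMono_renewalTime {ω : Env Bool} (h : ∀ i, 1 ≤ gap (renew^[i] ω)) :
    StrictMono (renewalTime ω) :=
  strictMono_nat_of_lt_succ fun k => by
    rw [renewalTime, renewalTime, Finset.sum_range_succ]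
    have := h k
    lia

lemma tendsto_renewalTime (hp0 : 0 < p) (hp1 : p < 1) (hθ : percLaw p {ω | Survives ω} ≠ 0) :
    ∀ᵐ ω ∂survivalLaw p, Tendsto (fun k : ℕ => (renewalTime ω k : ℝ) / k) atTop
      (𝓝 (∫ ω, (gap ω : ℝ) ∂survivalLaw p)) := by
  filter_upwards [strong_law_renew hp0 hp1 hθ (fun a => (a.1 : ℝ)) (integrable_gap hp0 hp1 hθ)]
    with ω hω
  simpa [renewalTime] using hω

lemma integral_gap_pos (hp0 : 0 < p) (hp1 : p < 1) (hθ : percLaw p {ω | Survives ω} ≠ 0) :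
    0 < ∫ ω, (gap ω : ℝ) ∂survivalLaw p := by
  have := isProbabilityMeasure_survivalLaw hθ
  have h : (fun _ => (1 : ℝ)) ≤ᵐ[survivalLaw p] fun ω => (gap ω : ℝ) := by
    filter_upwards [ae_iterate_renew hp0 hp1 hθ] with ω hω
    exact_mod_cast (hω.2 0).2.1
  have h1 := integral_mono_ae (integrable_const 1) (integrable_gap hp0 hp1 hθ) h
  have h2 : ∫ _ω, (1 : ℝ) ∂survivalLaw p = 1 := by simp
  linarith

lemma ae_rise_nonneg (hp0 : 0 < p) (hp1 : p < 1) (hθ : percLaw p {ω | Survives ω} ≠ 0) :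
    ∀ᵐ ω ∂survivalLaw p, 0 ≤ (rise ω : ℝ) := by
  filter_upwards [ae_iterate_renew hp0 hp1 hθ] with ω hω
  exact Int.cast_nonneg (hω.2 0).2.2

/- The sum of the rises up to the `n`-th renewal is at most the sum of the runs up to that column,
whose average converges by the law of large numbers. -/
lemma integrable_rise (hp0 : 0 < p) (hp1 : p < 1) (hθ : percLaw p {ω | Survives ω} ≠ 0) :
    Integrable (fun ω => (rise ω : ℝ)) (survivalLaw p) := by
  have := isProbabilityMeasure_survivalLaw hθ
  refine integrable_of_sum_iterate_le (measurePreserving_renew hp0 hp1 hθ)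
    (measurable_from_top.comp measurable_rise) (ae_rise_nonneg hp0 hp1 hθ)
    ((indepFun_gap_rise_renew hp0 hp1 hθ).comp
      (measurable_of_countable fun a : ℕ × ℤ => (a.2 : ℝ)) measurable_id)
    (b := fun n ω => (runSum ω (renewalTime ω n) : ℝ))
    (C := (∫ ω, (run ω : ℝ) ∂percLaw p) * ∫ ω, (gap ω : ℝ) ∂survivalLaw p) ?_ ?_
  · filter_upwards [ae_iterate_renew hp0 hp1 hθ] with ω ⟨htyp, hω⟩ n
    have htop := (iterate_renew htyp (fun i => (hω i).1) n).2
    exact_mod_cast htop.symm.trans_le (htyp.top_le_runSum (renewalTime ω n))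
  · filter_upwards [ae_iterate_renew hp0 hp1 hθ, tendsto_renewalTime hp0 hp1 hθ,
      cond_absolutelyContinuous.ae_le (tendsto_runSum hp1)] with ω hω hT hrun
    have hmono := strictMono_renewalTime fun i => (hω.2 i).2.1
    refine ((hrun.comp hmono.tendsto_atTop).mul hT).congr' ?_
    filter_upwards [eventually_gt_atTop 0] with n hn
    have hpos : 0 < renewalTime ω n := hn.trans_le (hmono.id_le n)
    exact div_mul_div_cancel₀ (Nat.cast_ne_zero.2 hpos.ne')

lemma tendsto_top_div (hp0 : 0 < p) (hp1 : p < 1) (hθ : percLaw p {ω | Survives ω} ≠ 0) :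
    ∀ᵐ ω ∂survivalLaw p, Tendsto (fun n : ℕ => (top ω n : ℝ) / n) atTop
      (𝓝 ((∫ ω, (rise ω : ℝ) ∂survivalLaw p) / ∫ ω, (gap ω : ℝ) ∂survivalLaw p)) := by
  filter_upwards [ae_iterate_renew hp0 hp1 hθ, tendsto_renewalTime hp0 hp1 hθ,
    strong_law_renew hp0 hp1 hθ (fun a => (a.2 : ℝ)) (integrable_rise hp0 hp1 hθ),
    cond_absolutelyContinuous.ae_le (tendsto_runSum hp1)] with ω ⟨htyp, hω⟩ hT hrise hrun
  have hiter := iterate_renew htyp fun i => (hω i).1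
  refine tendsto_div_of_tendsto_comp_div (strictMono_renewalTime fun i => (hω i).2.1)
    (by simp [renewalTime]) (integral_gap_pos hp0 hp1 hθ).ne' hT
    (a := fun n => (top ω n : ℝ)) (s := fun n => (runSum ω n : ℝ))
    (hrise.congr fun n => by rw [(hiter n).2]; push_cast; rfl) hrun (fun k n hkn => ?_)
    (fun k n hkn => ?_)
  · have hren : IsRenewal ω (renewalTime ω k) := by
      have hsurv := (hω k).1
      rwa [(hiter k).1] at hsurv
    exact_mod_cast htyp.top_mono_of_isRenewal hren hkn
  · have hle : (top ω n : ℝ) + runSum ω (renewalTime ω k) ≤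
        top ω (renewalTime ω k) + runSum ω n := by
      exact_mod_cast htyp.top_le_add_runSum hkn
    linarith

/-- `l` is the almost sure rate of growth of the highest entry point on the event that the origin
survives: the slope of the upper boundary of the cluster, with columns numbered from right to
left. -/
def IsSlope (p : unitInterval) (l : ℝ) : Prop :=
  ∀ᵐ ω ∂percLaw p, Survives ω → Tendsto (fun n : ℕ => (top ω n : ℝ) / n) atTop (𝓝 l)

lemma exists_isSlope (hp0 : 0 < p) (hp1 : p < 1) (hθ : percLaw p {ω | Survives ω} ≠ 0) :
    ∃ l : ℝ, 0 ≤ l ∧ IsSlope p l :=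
  ⟨_, div_nonneg (integral_nonneg_of_ae (ae_rise_nonneg hp0 hp1 hθ))
    (integral_gap_pos hp0 hp1 hθ).le, ae_of_ae_survivalLaw (tendsto_top_div hp0 hp1 hθ)⟩

end Slope

section MeanHeight

variable {p : unitInterval} {l : ℝ}

/-- The mean height of the highest entry point into column `n`. -/
noncomputable def meanTop (p : unitInterval) (n : ℕ) : ℝ := ∫ ω, (top ω n : ℝ) ∂percLaw p

lemma Typical.top_mul_le {ω : Env Bool} (h : Typical ω) (k n : ℕ) :
    top ω (n * k) ≤ ∑ i ∈ Finset.range n, top (fromTop (i * k) ω) k := by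
  induction n with
  | zero => simp
  | succ n ih =>
    rw [Finset.sum_range_succ, add_mul, one_mul]
    have hadd := h.top_add_le (n * k) k
    rw [← fromTop] at hadd
    lia

lemma slope_mul_le_meanTop (hp0 : 0 < p) (hp1 : p < 1) (hθ : percLaw p {ω | Survives ω} ≠ 0)
    (hl : IsSlope p l) {k : ℕ} (hk : 0 < k) : l * k ≤ meanTop p k := by
  have := isProbabilityMeasure_survivalLaw hθ
  have hmean := strong_law_fromTop p (k := k) (measurable_top_real k)
    (fun _ _ h => by simp only [dependsOn_top k h]) (integrable_top hp0 hp1 k)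
  obtain ⟨ω, hslope, htyp, hmean⟩ := ((ae_survivalLaw hl).and
    (cond_absolutelyContinuous.ae_le ((ae_typical hp0 hp1).and hmean))).exists
  have hnk : Tendsto (fun n : ℕ => n * k) atTop atTop := tendsto_id.atTop_mul_const' hk
  refine le_of_tendsto_of_tendsto' ((hslope.comp hnk).mul_const (k : ℝ)) hmean fun n => ?_
  calc (top ω (n * k) : ℝ) / (n * k : ℕ) * k = (top ω (n * k) : ℝ) / n := by
        rw [Nat.cast_mul, div_mul_eq_mul_div, mul_div_mul_right _ _ (Nat.cast_ne_zero.2 hk.ne')]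
    _ ≤ (∑ i ∈ Finset.range n, (top (fromTop (i * k) ω) k : ℝ)) / n :=
        div_le_div_of_nonneg_right (by exact_mod_cast htyp.top_mul_le k n) n.cast_nonneg

lemma tendsto_top_div_of_isRenewal (hp0 : 0 < p) (hp1 : p < 1) (hl : IsSlope p l) :
    ∀ᵐ ω ∂percLaw p, (∃ j, IsRenewal ω j) →
      Tendsto (fun n : ℕ => (top ω n : ℝ) / n) atTop (𝓝 l) := by
  have hslope := ae_all_iff.2 fun j =>
    (measurePreserving_fromTop p j).quasiMeasurePreserving.ae hl
  filter_upwards [hslope, ae_typical hp0 hp1] with ω hslope htyp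
  rintro ⟨j, hj⟩
  rw [← tendsto_add_atTop_iff_nat j]
  have hratio : Tendsto (fun n : ℕ => (n : ℝ) / ((n + j : ℕ) : ℝ)) atTop (𝓝 1) := by
    simpa using tendsto_natCast_div_add_atTop (𝕜 := ℝ) (j : ℝ)
  have hzero : Tendsto (fun n : ℕ => (top ω j : ℝ) / ((n + j : ℕ) : ℝ)) atTop (𝓝 0) :=
    tendsto_const_nhds.div_atTop
      (tendsto_natCast_atTop_atTop.comp (tendsto_add_atTop_nat j))
  have hsum := hzero.add ((hslope j hj).mul hratio)
  rw [zero_add, mul_one] at hsum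
  refine hsum.congr' ?_
  filter_upwards [eventually_gt_atTop 0] with n hn
  rw [add_comm n j, htyp.top_add (hj n), div_mul_div_cancel₀ (Nat.cast_ne_zero.2 hn.ne'),
    ← add_div, fromTop, Int.cast_add]

/-- The average over the first `n` columns of the run above the highest entry point minus the gain
in height, which is nonnegative. -/
noncomputable def meanLoss (n : ℕ) (ω : Env Bool) : ℝ := (runSum ω n - top ω n) / n

lemma measurable_meanLoss (n : ℕ) : Measurable (meanLoss n) :=
  ((measurable_from_top.comp (measurable_runSum n) : Measurable fun ω => (runSum ω n : ℝ)).sub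
    (measurable_top_real n)).div_const _

lemma dependsOn_meanLoss (n : ℕ) : DependsOn (meanLoss n) (columnsBefore n) := fun ω ω' h => by
  rw [meanLoss, meanLoss, show top ω n = top ω' n from dependsOn_top n h,
    show runSum ω n = runSum ω' n from dependsOn_runSum n h]

lemma Typical.meanLoss_nonneg {ω : Env Bool} (h : Typical ω) (n : ℕ) : 0 ≤ meanLoss n ω :=
  div_nonneg (sub_nonneg.2 (by exact_mod_cast h.top_le_runSum n)) n.cast_nonneg

lemma integrable_meanLoss (hp0 : 0 < p) (hp1 : p < 1) (n : ℕ) :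
    Integrable (meanLoss n) (percLaw p) :=
  ((integrable_runSum hp1 n).sub (integrable_top hp0 hp1 n)).div_const _

lemma integral_meanLoss (hp0 : 0 < p) (hp1 : p < 1) {n : ℕ} (hn : n ≠ 0) :
    ∫ ω, meanLoss n ω ∂percLaw p = (∫ ω, (run ω : ℝ) ∂percLaw p) - meanTop p n / n := by
  simp only [meanLoss]
  rw [integral_div, integral_sub (integrable_runSum hp1 n) (integrable_top hp0 hp1 n),
    integral_runSum hp1, ← meanTop, sub_div, mul_div_cancel_left₀ _ (Nat.cast_ne_zero.2 hn)]

lemma setIntegral_isRenewal_meanLoss (p : unitInterval) (n : ℕ) :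
    ∫ ω in {ω | IsRenewal ω n}, meanLoss n ω ∂percLaw p =
      (percLaw p).real {ω | IsRenewal ω n} * ∫ ω, meanLoss n ω ∂percLaw p :=
  Indep.setIntegral_eq_mul (f := id) (measurable_fromTop n).comap_le
    (indepFun_restart _ (measurable_top n) (dependsOn_top n) (measurable_meanLoss n)
      (dependsOn_meanLoss n)).symm (measurable_meanLoss n).aemeasurable
    ⟨_, measurableSet_survives, rfl⟩ aestronglyMeasurable_id

lemma tendsto_meanTop_div (hp0 : 0 < p) (hp1 : p < 1) (hθ : percLaw p {ω | Survives ω} ≠ 0)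
    (hl : IsSlope p l) : Tendsto (fun n : ℕ => meanTop p n / n) atTop (𝓝 l) := by
  refine tendsto_order.2 ⟨fun a ha => ?_, fun a ha => ?_⟩
  · filter_upwards [eventually_gt_atTop 0] with n hn
    exact ha.trans_le ((le_div_iff₀ (Nat.cast_pos.2 hn)).2 (slope_mul_le_meanTop hp0 hp1 hθ hl hn))
  set meanRun := ∫ ω, (run ω : ℝ) ∂percLaw p
  have hloss : ∀ᵐ ω ∂percLaw p, ω ∈ ⋃ n, {ω | IsRenewal ω n} →
      Tendsto (fun n => meanLoss n ω) atTop (𝓝 (meanRun - l)) := by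
    filter_upwards [tendsto_top_div_of_isRenewal hp0 hp1 hl, tendsto_runSum hp1]
      with ω htop hrun hren
    exact (hrun.sub (htop (Set.mem_iUnion.1 hren))).congr fun n => (sub_div _ _ _).symm
  filter_upwards [eventually_gt_atTop 0, eventually_lt_integral_of_tendsto_on_iUnion
    measurable_meanLoss ((ae_typical hp0 hp1).mono fun ω h => h.meanLoss_nonneg)
    (integrable_meanLoss hp0 hp1) (fun n => measurableSet_setOfPred.2 (measurable_isRenewal n))
    (ENNReal.toReal_pos hθ (measure_ne_top _ _))
    (fun n => (measurePreserving_fromTop p n).measureReal_preimage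
      measurableSet_survives.nullMeasurableSet)
    (setIntegral_isRenewal_meanLoss p) hloss (sub_lt_sub_left ha meanRun)] with n hn hlt
  rw [integral_meanLoss hp0 hp1 hn.ne'] at hlt
  linarith

end MeanHeight

section Coupling

/-- Environments at all densities, driven by common labels: `i` is occupied at density `r i` when
its label is at most `r i`. -/
noncomputable def threshold (r : ℕ × ℤ → unitInterval) (U : Env unitInterval) : Env Bool :=
  fun i => decide (U i ≤ r i)

/-- The law of independent uniform labels. -/
noncomputable abbrev labelLaw : Measure (Env unitInterval) := envLaw volume

lemma preimage_decide_le (p : unitInterval) :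
    (fun u : unitInterval => decide (u ≤ p)) ⁻¹' {true} = Set.Iic p := by ext; simp

lemma measurable_decide_le (p : unitInterval) :
    Measurable fun u : unitInterval => decide (u ≤ p) :=
  measurable_to_bool (by rw [preimage_decide_le]; exact measurableSet_Iic)

lemma measurable_threshold (r : ℕ × ℤ → unitInterval) : Measurable (threshold r) := by
  refine measurable_pi_lambda _ fun i => ?_
  exact (measurable_decide_le (r i)).comp (measurable_pi_apply i)

lemma map_decide_le (p : unitInterval) :
    (volume : Measure unitInterval).map (fun u => decide (u ≤ p)) =
      bernoulliMeasure true false p := by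
  have h2 : (fun u : unitInterval => decide (u ≤ p)) ⁻¹' {false} = Set.Ioi p := by ext; simp
  refine Measure.ext_of_singleton fun b => ?_
  rw [Measure.map_apply (measurable_decide_le p) (measurableSet_singleton b)]
  cases b
  · rw [h2, unitInterval.volume_Ioi, bernoulliMeasure_apply p (measurableSet_singleton _)]
    have : (1 - (p : ℝ)).toNNReal = unitInterval.toNNReal (unitInterval.symm p) :=
      NNReal.eq (by rw [Real.coe_toNNReal _ (by linarith [p.2.2])]; simp)
    simp [ENNReal.ofReal, this]
  · rw [preimage_decide_le, unitInterval.volume_Iic,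
      bernoulliMeasure_apply p (measurableSet_singleton _)]
    have : (p : ℝ).toNNReal = unitInterval.toNNReal p :=
      NNReal.eq (by rw [Real.coe_toNNReal _ p.2.1]; simp)
    simp [ENNReal.ofReal, this]

lemma measurePreserving_threshold (p : unitInterval) :
    MeasurePreserving (threshold fun _ => p) labelLaw (percLaw p) := by
  refine ⟨measurable_threshold _, ?_⟩
  have := Measure.infinitePi_map_pi (fun _ : ℕ × ℤ => (volume : Measure unitInterval))
    (f := fun _ u => decide (u ≤ p)) fun _ => measurable_decide_le p
  rw [map_decide_le] at this
  exact this

lemma threshold_mono {r r' : ℕ × ℤ → unitInterval} (h : ∀ i, r i ≤ r' i) (U : Env unitInterval)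
    (i : ℕ × ℤ) (hi : threshold r U i = true) : threshold r' U i = true := by
  simp only [threshold, decide_eq_true_eq] at hi ⊢
  exact hi.trans (h i)

variable {p q : unitInterval}

lemma Survives.mono {ω ω' : Env Bool} (h : ∀ i, ω i = true → ω' i = true) (hs : Survives ω) :
    Survives ω' :=
  fun n => (hs n).mono (entry_mono_env h subset_rfl n)

lemma percLaw_survives_mono (hqp : q ≤ p) :
    percLaw q {ω | Survives ω} ≤ percLaw p {ω | Survives ω} := by
  rw [← (measurePreserving_threshold q).measure_preimage measurableSet_survives.nullMeasurableSet,
    ← (measurePreserving_threshold p).measure_preimage measurableSet_survives.nullMeasurableSet]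
  exact measure_mono fun U hU => Survives.mono (threshold_mono (fun _ => hqp) U) hU

/-- Density `p` in the first `k` columns and `q` in the others. It interpolates between the two
homogeneous densities one column at a time. -/
def mixed (p q : unitInterval) (k : ℕ) (i : ℕ × ℤ) : unitInterval := if i.1 < k then p else q

lemma le_mixed (hqp : q ≤ p) (k : ℕ) (i : ℕ × ℤ) : q ≤ mixed p q k i := by
  rw [mixed]
  split_ifs
  exacts [hqp, le_rfl]

lemma mixed_le (hqp : q ≤ p) (k : ℕ) (i : ℕ × ℤ) : mixed p q k i ≤ p := by
  rw [mixed]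
  split_ifs
  exacts [le_rfl, hqp]

lemma mixed_le_mixed (hqp : q ≤ p) {k l : ℕ} (hkl : k ≤ l) (i : ℕ × ℤ) :
    mixed p q k i ≤ mixed p q l i := by
  by_cases hi : i.1 < k
  · rw [mixed, mixed, if_pos hi, if_pos (hi.trans_le hkl)]
  · rw [mixed, if_neg hi]
    exact le_mixed hqp l i

lemma typical_mixed (hqp : q ≤ p) {U : Env unitInterval} (hp : Typical (threshold (fun _ => p) U))
    (hq : Typical (threshold (fun _ => q) U)) (k : ℕ) : Typical (threshold (mixed p q k) U) := by
  intro n b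
  constructor
  · by_cases hn : n < k
    · simpa [threshold, mixed, hn] using (hp n b).1
    · simpa [threshold, mixed, hn] using (hq n b).1
  · obtain ⟨y, hy, hr⟩ := (hq n b).2
    exact ⟨y, hy, fun i hi => threshold_mono (le_mixed hqp k) U (i, y) (hr i hi)⟩

lemma Typical.top_le_top {ω ω' : Env Bool} (h : Typical ω) (h' : Typical ω')
    (hle : ∀ i, ω i = true → ω' i = true) (n : ℕ) : top ω n ≤ top ω' n :=
  (h'.isGreatest_entry_Iic n).2 (entry_mono_env hle subset_rfl n (h.isGreatest_entry_Iic n).1)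

lemma shift_threshold_mixed {j k : ℕ} (hjk : j ≤ k) (y : ℤ) (U : Env unitInterval) :
    shift k y (threshold (mixed p q j) U) = threshold (fun _ => q) (shift k y U) := by
  funext i
  have : ¬ i.1 + k < j := by lia
  simp only [shift, threshold]
  exact decide_eq_decide.2 (by simp [mixed, this])

lemma top_threshold_mixed {n k : ℕ} (hnk : n ≤ k) (U : Env unitInterval) :
    top (threshold (mixed p q k) U) n = top (threshold (fun _ => p) U) n := by
  refine top_congr fun i hi => ?_
  have : i.1 < k := hi.trans_le hnk
  simp [threshold, mixed, this]

/-- The gain in column `m` from raising the half-line of starting points by one. -/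
noncomputable def stepGain (m : ℕ) (ω : Env Bool) : ℤ := top ω m - top (shift 0 (-1) ω) m + 1

lemma Typical.stepGain_nonpos {ω : Env Bool} (h : Typical ω) {m : ℕ}
    (hne : ¬ (entry ω {0} m).Nonempty) : stepGain m ω ≤ 0 := by
  have h1 := (h.isGreatest_entry_Iic m).1
  have h2 : Set.Iic (0 : ℤ) = {0} ∪ Set.Iic (-1) := by
    ext z
    simp only [Set.mem_Iic, Set.singleton_union, Set.mem_insert_iff]
    lia
  rw [h2, entry_union, Set.not_nonempty_iff_eq_empty.1 hne, Set.empty_union] at h1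
  have h3 : top ω m + 1 ∈ entry (shift 0 (-1) ω) (Set.Iic 0) m :=
    mem_entry_shift_Iic.2 (by simpa using h1)
  have := ((h.comp_shift 0 (-1)).isGreatest_entry_Iic m).2 h3
  rw [stepGain]
  lia

/- The new highest entry point is one at which `U` restarts with density `q`. If it does not reach
the target column, then the step gain is nonpositive and monotonicity is enough. -/
lemma stepGain_le (hqp : q ≤ p) {U : Env unitInterval} (hp : Typical (threshold (fun _ => p) U))
    (hq : Typical (threshold (fun _ => q) U)) {k m : ℕ}
    (hlt : top (threshold (mixed p q k) U) (k + 1) < top (threshold (fun _ => p) U) (k + 1)) :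
    stepGain m (threshold (fun _ => q)
        (shift (k + 1) (top (threshold (fun _ => p) U) (k + 1)) U)) ≤
      top (threshold (mixed p q (k + 1)) U) (k + 1 + m) -
        top (threshold (mixed p q k) U) (k + 1 + m) := by
  have hg := typical_mixed hqp hp hq k
  have hg' := typical_mixed hqp hp hq (k + 1)
  have htop := top_threshold_mixed (p := p) (q := q) (le_refl (k + 1)) U
  rw [← htop] at hlt ⊢
  set ω := threshold (mixed p q k) U
  set ω' := threshold (mixed p q (k + 1)) U
  have hsh : ∀ y, threshold (fun _ => q) (shift (k + 1) y U) = shift (k + 1) y ω' :=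
    fun y => (shift_threshold_mixed le_rfl y U).symm
  have hsh' : ∀ y, shift (k + 1) y ω' = shift (k + 1) y ω := fun y =>
    (shift_threshold_mixed le_rfl y U).trans (shift_threshold_mixed (Nat.le_succ k) y U).symm
  rw [hsh]
  by_cases hne : (entry (shift (k + 1) (top ω' (k + 1)) ω') {0} m).Nonempty
  · have h1 := hg'.top_add hne
    have h2 := hg.top_add_le_of_le (k := k + 1) (b := top ω' (k + 1) - 1) (by lia) m
    have h3 : shift 0 (-1) (shift (k + 1) (top ω' (k + 1)) ω') =
        shift (k + 1) (top ω' (k + 1) - 1) ω := by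
      rw [shift_shift, hsh']
      rfl
    rw [stepGain, h3]
    lia
  · have h1 := (hg'.comp_shift (k + 1) (top ω' (k + 1))).stepGain_nonpos hne
    have h2 := hg.top_le_top hg' (threshold_mono (mixed_le_mixed hqp (Nat.le_succ k)) U) (k + 1 + m)
    lia

lemma top_lt_top_of_mem_Ioc (hqp : q ≤ p) {U : Env unitInterval}
    (hp : Typical (threshold (fun _ => p) U)) (hq : Typical (threshold (fun _ => q) U)) {k : ℕ}
    (hU : U (k, top (threshold (fun _ => p) U) k) ∈ Set.Ioc q p) :
    top (threshold (mixed p q k) U) (k + 1) < top (threshold (fun _ => p) U) (k + 1) := by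
  have hg := typical_mixed hqp hp hq k
  have htop := top_threshold_mixed (p := p) (q := q) (le_refl k) U
  have h1 : top (threshold (fun _ => p) U) k + 1 ≤ top (threshold (fun _ => p) U) (k + 1) := by
    refine (hp.isGreatest_entry_Iic (k + 1)).2 ⟨_, (hp.isGreatest_entry_Iic k).1, _, le_rfl,
      fun u h1 h2 => ?_, Or.inr rfl⟩
    rw [le_antisymm h2 h1]
    simpa [threshold] using hU.2
  have h2 : top (threshold (mixed p q k) U) (k + 1) ≤ top (threshold (fun _ => p) U) k := by
    obtain ⟨e, he, y, -, hr, hz⟩ := (hg.isGreatest_entry_Iic (k + 1)).1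
    have h3 := (hg.isGreatest_entry_Iic k).2 he
    rw [htop] at h3
    by_contra hlt
    have h4 := hr (top (threshold (fun _ => p) U) k) h3 (by lia)
    simp only [threshold, mixed, lt_irrefl, if_false, decide_eq_true_eq] at h4
    exact absurd h4 (not_le.2 hU.1)
  lia

lemma measurable_stepGain (m : ℕ) : Measurable fun ω => (stepGain m ω : ℝ) := by
  have : Measurable fun ω => stepGain m ω :=
    ((measurable_top m).sub ((measurable_top m).comp (measurable_shift 0 (-1)))).add_const 1
  exact measurable_from_top.comp this

lemma integrable_stepGain (hq0 : 0 < q) (hq1 : q < 1) (m : ℕ) :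
    Integrable (fun ω => (stepGain m ω : ℝ)) (percLaw q) := by
  have h := integrable_top hq0 hq1 m
  have h' := (measurePreserving_shift (bernoulliMeasure true false q) 0
    (-1)).integrable_comp_of_integrable h
  refine ((h.sub h').add (integrable_const 1)).congr (ae_of_all _ fun ω => ?_)
  simp [stepGain]

lemma integral_stepGain (hq0 : 0 < q) (hq1 : q < 1) (m : ℕ) :
    ∫ ω, (stepGain m ω : ℝ) ∂percLaw q = 1 := by
  have h := integrable_top hq0 hq1 m
  have hmp := measurePreserving_shift (bernoulliMeasure true false q) 0 (-1)
  have h' : Integrable (fun ω => (top (shift 0 (-1) ω) m : ℝ)) (percLaw q) :=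
    hmp.integrable_comp_of_integrable h
  have heq := integral_comp_measurePreserving hmp (measurable_top_real m)
  simp only [stepGain, Int.cast_add, Int.cast_sub, Int.cast_one]
  rw [integral_add (f := fun ω => (top ω m : ℝ) - top (shift 0 (-1) ω) m) (h.sub h')
    (integrable_const 1), integral_sub h h', heq]
  simp

lemma ae_typical_threshold (hp0 : 0 < p) (hp1 : p < 1) :
    ∀ᵐ U ∂labelLaw, Typical (threshold (fun _ => p) U) :=
  (measurePreserving_threshold p).quasiMeasurePreserving.ae (ae_typical hp0 hp1)

lemma measurable_top_threshold (r : ℕ × ℤ → unitInterval) (n : ℕ) :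
    Measurable fun U => top (threshold r U) n :=
  (measurable_top n).comp (measurable_threshold r)

lemma dependsOn_top_threshold (r : ℕ × ℤ → unitInterval) (n : ℕ) :
    DependsOn (fun U => top (threshold r U) n) (columnsBefore n) :=
  fun U U' h => top_congr fun i hi => by simp only [threshold, h i hi]

lemma integrable_top_threshold (hp0 : 0 < p) (hp1 : p < 1) (n : ℕ) :
    Integrable (fun U => (top (threshold (fun _ => p) U) n : ℝ)) labelLaw :=
  (measurePreserving_threshold p).integrable_comp_of_integrable (integrable_top hp0 hp1 n)

lemma integrable_top_mixed (hq0 : 0 < q) (hqp : q ≤ p) (hp1 : p < 1) (k n : ℕ) :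
    Integrable (fun U => (top (threshold (mixed p q k) U) n : ℝ)) labelLaw := by
  have hp0 := hq0.trans_le hqp
  have hq1 := hqp.trans_lt hp1
  refine ((integrable_top_threshold hp0 hp1 n).abs.add
    (integrable_top_threshold hq0 hq1 n).abs).mono'
    (measurable_from_top.comp (measurable_top_threshold _ n)).aestronglyMeasurable ?_
  filter_upwards [ae_typical_threshold hp0 hp1, ae_typical_threshold hq0 hq1] with U hp hq
  have hmixed := typical_mixed hqp hp hq k
  have hlower : (top (threshold (fun _ => q) U) n : ℝ) ≤ top (threshold (mixed p q k) U) n :=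
    Int.cast_le.2 (hq.top_le_top hmixed (threshold_mono (le_mixed hqp k) U) n)
  have hupper : (top (threshold (mixed p q k) U) n : ℝ) ≤ top (threshold (fun _ => p) U) n :=
    Int.cast_le.2 (hmixed.top_le_top hp (threshold_mono (mixed_le hqp k) U) n)
  rw [Real.norm_eq_abs, Pi.add_apply, add_comm]
  exact (abs_le_max_abs_abs hlower hupper).trans
    (max_le_add_of_nonneg (abs_nonneg _) (abs_nonneg _))

/-- The labels for which giving column `k` the density `p` instead of `q` raises the highest entry
point into column `k + 1`. -/
def raised (p q : unitInterval) (k : ℕ) : Set (Env unitInterval) :=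
  {U | top (threshold (mixed p q k) U) (k + 1) < top (threshold (fun _ => p) U) (k + 1)}

lemma measurableSet_raised (p q : unitInterval) (k : ℕ) : MeasurableSet (raised p q k) :=
  measurableSet_lt (measurable_top_threshold _ _) (measurable_top_threshold _ _)

lemma dependsOn_mem_raised (p q : unitInterval) (k : ℕ) :
    DependsOn (fun U => U ∈ raised p q k) (columnsBefore (k + 1)) := fun _ _ h =>
  congr_arg₂ (· < ·) (dependsOn_top_threshold _ _ h) (dependsOn_top_threshold _ _ h)

lemma sub_le_measureReal_raised (hq0 : 0 < q) (hqp : q ≤ p) (hp1 : p < 1) (k : ℕ) :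
    (p : ℝ) - q ≤ labelLaw.real (raised p q k) := by
  let C : Set (Env unitInterval) := (fun V => V (0, 0)) ⁻¹' Set.Ioc q p
  have hC : MeasurableSet C := measurable_pi_apply _ measurableSet_Ioc
  have hCm : labelLaw C = ENNReal.ofReal (p - q) := by
    rw [← unitInterval.volume_Ioc]
    exact (measurePreserving_eval_infinitePi (fun _ : ℕ × ℤ => (volume : Measure unitInterval))
      (0, 0)).measure_preimage measurableSet_Ioc.nullMeasurableSet
  have hrestart := measurePreserving_restart (volume : Measure unitInterval)
    (measurable_top_threshold (fun _ => p) k) (dependsOn_top_threshold (fun _ => p) k)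
  rw [measureReal_def, ← ENNReal.ofReal_le_iff_le_toReal (measure_ne_top _ _), ← hCm,
    ← hrestart.measure_preimage hC.nullMeasurableSet]
  refine measure_mono_ae ?_
  filter_upwards [ae_typical_threshold (hq0.trans_le hqp) hp1,
    ae_typical_threshold hq0 (hqp.trans_lt hp1)] with U hp hq hU
  have hlabel : shift k (top (threshold (fun _ => p) U) k) U (0, 0) ∈ Set.Ioc q p := hU
  exact top_lt_top_of_mem_Ioc hqp hp hq (by simpa [shift] using hlabel)

/-- The step gain at density `q` of the labels seen from the highest entry point into column `k + 1`
at density `p`. -/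
noncomputable def restartGain (p q : unitInterval) (k m : ℕ) (U : Env unitInterval) : ℝ :=
  stepGain m (threshold (fun _ => q) (shift (k + 1) (top (threshold (fun _ => p) U) (k + 1)) U))

lemma measurePreserving_threshold_restart (p q : unitInterval) (k : ℕ) :
    MeasurePreserving (fun U => threshold (fun _ => q)
      (shift (k + 1) (top (threshold (fun _ => p) U) (k + 1)) U)) labelLaw (percLaw q) :=
  (measurePreserving_threshold q).comp (measurePreserving_restart _
    (measurable_top_threshold _ (k + 1)) (dependsOn_top_threshold _ (k + 1)))

lemma integrable_restartGain (p : unitInterval) (hq0 : 0 < q) (hq1 : q < 1) (k m : ℕ) :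
    Integrable (restartGain p q k m) labelLaw :=
  (measurePreserving_threshold_restart p q k).integrable_comp_of_integrable
    (integrable_stepGain hq0 hq1 m)

lemma setIntegral_raised_restartGain (p : unitInterval) (hq0 : 0 < q) (hq1 : q < 1) (k m : ℕ) :
    ∫ U in raised p q k, restartGain p q k m U ∂labelLaw = labelLaw.real (raised p q k) := by
  have hgain : Measurable (restartGain p q k m) :=
    (measurable_stepGain m).comp (measurePreserving_threshold_restart p q k).measurable
  have hmean : ∫ U, restartGain p q k m U ∂labelLaw = 1 :=
    (integral_comp_measurePreserving (measurePreserving_threshold_restart p q k)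
      (measurable_stepGain m)).trans (integral_stepGain hq0 hq1 m)
  have hmem : Measurable fun U => U ∈ raised p q k := measurable_mem.2 (measurableSet_raised p q k)
  have hindep : IndepFun (fun U => U ∈ raised p q k) (restartGain p q k m) labelLaw :=
    (indepFun_restart _ (measurable_top_threshold (fun _ => p) (k + 1))
      (dependsOn_top_threshold _ _) hmem (dependsOn_mem_raised p q k)).comp measurable_id
      ((measurable_stepGain m).comp (measurable_threshold fun _ => q))
  have hmul : ∫ U in raised p q k, restartGain p q k m U ∂labelLaw =
      labelLaw.real (raised p q k) * ∫ U, restartGain p q k m U ∂labelLaw :=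
    Indep.setIntegral_eq_mul (f := id) hmem.comap_le hindep hgain.aemeasurable
      ⟨{True}, trivial, by ext; simp⟩ aestronglyMeasurable_id
  rw [hmul, hmean, mul_one]

lemma integral_top_mixed_succ (hq0 : 0 < q) (hqp : q ≤ p) (hp1 : p < 1) (k m : ℕ) :
    ∫ U, (top (threshold (mixed p q k) U) (k + 1 + m) : ℝ) ∂labelLaw + (p - q) ≤
      ∫ U, (top (threshold (mixed p q (k + 1)) U) (k + 1 + m) : ℝ) ∂labelLaw := by
  have hq1 := hqp.trans_lt hp1
  have htyp := (ae_typical_threshold (hq0.trans_le hqp) hp1).and (ae_typical_threshold hq0 hq1)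
  have hint := integrable_top_mixed hq0 hqp hp1 k (k + 1 + m)
  have hint' := integrable_top_mixed hq0 hqp hp1 (k + 1) (k + 1 + m)
  have hgain : (p : ℝ) - q ≤
      ∫ U, ((top (threshold (mixed p q (k + 1)) U) (k + 1 + m) : ℝ) -
        top (threshold (mixed p q k) U) (k + 1 + m)) ∂labelLaw := by
    refine (sub_le_measureReal_raised hq0 hqp hp1 k).trans ?_
    rw [← setIntegral_raised_restartGain p hq0 hq1 k m]
    refine (setIntegral_mono_on_ae (integrable_restartGain p hq0 hq1 k m).integrableOn
      (hint'.sub hint).integrableOn (measurableSet_raised p q k) ?_).trans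
      (setIntegral_le_integral (hint'.sub hint) ?_)
    · filter_upwards [htyp] with U ⟨hp, hq⟩ hU
      simp only [restartGain, Pi.sub_apply]
      exact_mod_cast stepGain_le hqp hp hq hU
    · filter_upwards [htyp] with U ⟨hp, hq⟩
      exact sub_nonneg.2 (Int.cast_le.2 ((typical_mixed hqp hp hq k).top_le_top
        (typical_mixed hqp hp hq (k + 1))
        (threshold_mono (mixed_le_mixed hqp (Nat.le_succ k)) U) (k + 1 + m)))
  rw [integral_sub hint' hint] at hgain
  linarith

lemma meanTop_add_le (hq0 : 0 < q) (hqp : q ≤ p) (hp1 : p < 1) (n : ℕ) :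
    meanTop q n + n * (p - q) ≤ meanTop p n := by
  have key : ∀ k ≤ n, meanTop q n + k * (p - q) ≤
      ∫ U, (top (threshold (mixed p q k) U) n : ℝ) ∂labelLaw := by
    intro k
    induction k with
    | zero =>
      intro _
      have h : mixed p q 0 = fun _ => q := by funext i; simp [mixed]
      rw [h, integral_comp_measurePreserving (measurePreserving_threshold q)
        (measurable_top_real n)]
      simp [meanTop]
    | succ k ih =>
      intro hk
      obtain ⟨m, rfl⟩ := Nat.exists_eq_add_of_le hk
      have h1 := ih (by lia)
      have h2 := integral_top_mixed_succ hq0 hqp hp1 k m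
      push_cast
      linarith
  refine (key n le_rfl).trans_eq ?_
  simp only [top_threshold_mixed (le_refl n)]
  exact integral_comp_measurePreserving (measurePreserving_threshold p) (measurable_top_real n)

lemma IsSlope.add_le {l l' : ℝ} (hl : IsSlope q l) (hl' : IsSlope p l') (hq0 : 0 < q)
    (hqp : q ≤ p) (hp1 : p < 1) (hθ : percLaw q {ω | Survives ω} ≠ 0) : l + (p - q) ≤ l' := by
  have hθ' : percLaw p {ω | Survives ω} ≠ 0 := fun h =>
    hθ (le_antisymm ((percLaw_survives_mono hqp).trans h.le) zero_le)
  refine le_of_tendsto_of_tendsto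
    ((tendsto_meanTop_div hq0 (hqp.trans_lt hp1) hθ hl).add_const _)
    (tendsto_meanTop_div (hq0.trans_le hqp) hp1 hθ' hl') ?_
  filter_upwards [eventually_gt_atTop 0] with n hn
  have hn' : (0 : ℝ) < n := Nat.cast_pos.2 hn
  rw [div_add' _ _ _ hn'.ne', div_le_div_iff_of_pos_right hn', mul_comm _ (n : ℝ)]
  exact meanTop_add_le hq0 hqp hp1 n

end Coupling

section Cluster

/-- The part of a configuration that the cluster of the origin can see, with columns numbered from
right to left. -/
def toEnv (ω : Config) : Env Bool := fun i => ω (-(i.1 : ℤ), i.2)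

lemma measurePreserving_toEnv (p : unitInterval) : MeasurePreserving toEnv (law p) (percLaw p) := by
  have hinj : Function.Injective fun i : ℕ × ℤ => ((-(i.1 : ℤ), i.2) : ℤ × ℤ) := by
    rintro ⟨a, b⟩ ⟨c, d⟩ h
    simpa using h
  exact ⟨measurable_pi_lambda _ fun _ => measurable_pi_apply _,
    Measure.map_infinitePi_infinitePi_of_inj
      (P := fun _ : ℤ × ℤ => bernoulliMeasure true false p) hinj⟩

variable {ω : Config}

/-- The heights at which the cluster of the origin meets column `-n`. -/
def column (ω : Config) (n : ℕ) : Set ℤ := {x | (-(n : ℤ), x) ∈ forwardCluster ω 0}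

lemma sub_mem_steps_iff {x y : ℤ × ℤ} :
    y - x ∈ steps ↔ (y.1 = x.1 - 1 ∧ y.2 = x.2) ∨ (y.1 = x.1 ∧ y.2 = x.2 + 1) ∨
      (y.1 = x.1 - 1 ∧ y.2 = x.2 + 1) := by
  simp only [steps, Set.mem_insert_iff, Set.mem_singleton_iff, Prod.ext_iff, Prod.fst_sub,
    Prod.snd_sub]
  lia

/- A path in the cluster moves up a run of occupied sites in each column, starting at an entry
point. -/
lemma exists_entry_of_mem {z : ℤ × ℤ} (h : z ∈ forwardCluster ω 0) :
    ∃ n : ℕ, z.1 = -(n : ℤ) ∧ ∃ e ∈ entry (toEnv ω) {0} n, e ≤ z.2 ∧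
      ∀ u, e ≤ u → u < z.2 → toEnv ω (n, u) = true := by
  induction h with
  | refl => exact ⟨0, by simp, 0, rfl, le_rfl, fun u hu hu' => absurd hu (not_le.2 hu')⟩
  | @tail b c _ hbc ih =>
    obtain ⟨n, hn, e, he, hle, hrun⟩ := ih
    obtain ⟨hocc, hstep⟩ := hbc
    have hocc' : toEnv ω (n, b.2) = true := by rwa [toEnv, ← hn]
    have hrun' : ∀ u, e ≤ u → u ≤ b.2 → toEnv ω (n, u) = true := by
      intro u hu hub
      rcases hub.lt_or_eq with hlt | rfl
      exacts [hrun u hu hlt, hocc']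
    rcases sub_mem_steps_iff.1 hstep with ⟨h1, h2⟩ | ⟨h1, h2⟩ | ⟨h1, h2⟩
    · exact ⟨n + 1, by push_cast; lia, c.2, ⟨e, he, b.2, hle, hrun', Or.inl h2⟩, le_rfl,
        fun u hu hu' => absurd hu (not_le.2 hu')⟩
    · exact ⟨n, h1.trans hn, e, he, by lia, fun u hu hu' => hrun' u hu (by lia)⟩
    · exact ⟨n + 1, by push_cast; lia, c.2, ⟨e, he, b.2, hle, hrun', Or.inr h2⟩, le_rfl,
        fun u hu hu' => absurd hu (not_le.2 hu')⟩

lemma mem_forwardCluster_of_step {x y : ℤ × ℤ} (h : x ∈ forwardCluster ω 0) (hocc : ω x = true)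
    (hs : y - x ∈ steps) : y ∈ forwardCluster ω 0 :=
  Relation.ReflTransGen.tail h ⟨hocc, hs⟩

lemma mem_column_of_run {n : ℕ} {e y : ℤ} (h : e ∈ column ω n) (hey : e ≤ y)
    (hrun : ∀ u, e ≤ u → u < y → toEnv ω (n, u) = true) : y ∈ column ω n := by
  induction y, hey using Int.leInduction with
  | base => exact h
  | succ y hy ih =>
    exact mem_forwardCluster_of_step (ih fun u hu huy => hrun u hu (by lia))
      (hrun y hy (by lia)) (by simp [steps])

lemma entry_subset_column (n : ℕ) : entry (toEnv ω) {0} n ⊆ column ω n := by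
  induction n with
  | zero =>
    rintro _ rfl
    exact Relation.ReflTransGen.refl
  | succ n ih =>
    rintro z ⟨e, he, y, hey, hrun, hz⟩
    refine mem_forwardCluster_of_step
      (mem_column_of_run (ih he) hey fun u hu huy => hrun u hu huy.le) (hrun y hey le_rfl) ?_
    rcases hz with rfl | rfl <;> simp [steps]

lemma Typical.le_top_add_topRun (htyp : Typical (toEnv ω)) {n : ℕ} {y : ℤ} (h : y ∈ column ω n) :
    y ≤ top (toEnv ω) n + topRun (toEnv ω) n := by
  obtain ⟨k, hk, e, he, -, hrun⟩ := exists_entry_of_mem h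
  obtain rfl : n = k := by simpa using hk
  have hle := (htyp.isGreatest_entry_Iic n).2 (entry_mono (by simp) n he)
  by_contra! hlt
  have hocc := hrun (top (toEnv ω) n + topRun (toEnv ω) n) (by lia) hlt
  simp [htyp.topRun_spec] at hocc

lemma nonneg_of_mem_forwardCluster {z : ℤ × ℤ} (h : z ∈ forwardCluster ω 0) : 0 ≤ z.2 := by
  obtain ⟨k, -, e, he, hle, -⟩ := exists_entry_of_mem h
  obtain ⟨a, rfl, ha⟩ := exists_le_of_mem_entry he
  exact ha.trans hle

lemma Typical.survives_of_infinite (htyp : Typical (toEnv ω))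
    (h : (forwardCluster ω 0).Infinite) : Survives (toEnv ω) := by
  intro n
  by_contra hn
  refine h (Set.Finite.subset (s := ⋃ k ∈ Set.Iio n, (fun y : ℤ => (-(k : ℤ), y)) ''
    Set.Icc 0 (top (toEnv ω) k + topRun (toEnv ω) k)) ?_ ?_)
  · exact (Set.finite_Iio n).biUnion fun k _ => (Set.finite_Icc _ _).image _
  · rintro ⟨x, y⟩ hz
    obtain ⟨k, rfl : x = -k, e, he, -⟩ := exists_entry_of_mem hz
    have hkn : k < n := by
      by_contra! hle
      exact hn (nonempty_entry_of_le hle ⟨e, he⟩)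
    exact Set.mem_biUnion hkn
      ⟨y, ⟨nonneg_of_mem_forwardCluster hz, htyp.le_top_add_topRun hz⟩, rfl⟩

/- A path from the origin visits every column between its end points, since it moves at most one
column to the west at a time. -/
lemma exists_mem_column_le {n : ℕ} {z : ℤ × ℤ} (hz : z ∈ forwardCluster ω 0)
    (hn : z.1 ≤ -(n : ℤ)) : ∃ y ∈ column ω n, y ≤ z.2 := by
  induction hz with
  | refl =>
    obtain rfl : n = 0 := by simpa using hn
    exact ⟨0, Relation.ReflTransGen.refl, le_rfl⟩
  | @tail b c hb hbc ih =>
    have hstep := sub_mem_steps_iff.1 hbc.2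
    by_cases hbn : b.1 ≤ -(n : ℤ)
    · obtain ⟨y, hy, hyb⟩ := ih hbn
      exact ⟨y, hy, by lia⟩
    · have hc : (-(n : ℤ), c.2) = c := Prod.ext (by lia) rfl
      refine ⟨c.2, ?_, le_rfl⟩
      rw [column, Set.mem_ofPred_eq, hc]
      exact Relation.ReflTransGen.tail hb hbc

section Reflection

/-- The reflection exchanging the west and north steps. -/
def flip (z : ℤ × ℤ) : ℤ × ℤ := (-z.2, -z.1)

/-- The configuration seen in the mirror of `flip`, which exchanges columns and rows. -/
def reflect (ω : Config) : Config := fun z => ω (flip z)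

lemma flip_involutive : Function.Involutive flip := fun z => by simp [flip]

lemma reflect_reflect (ω : Config) : reflect (reflect ω) = ω :=
  funext fun z => congr_arg ω (flip_involutive z)

lemma measurePreserving_reflect (p : unitInterval) :
    MeasurePreserving reflect (law p) (law p) :=
  ⟨measurable_pi_lambda _ fun _ => measurable_pi_apply _,
    Measure.map_infinitePi_infinitePi_of_inj
      (P := fun _ : ℤ × ℤ => bernoulliMeasure true false p) flip_involutive.injective⟩

lemma flip_mem_forwardCluster_reflect {z : ℤ × ℤ} (h : z ∈ forwardCluster ω 0) :
    flip z ∈ forwardCluster (reflect ω) 0 := by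
  refine Relation.ReflTransGen.lift (r := fun a b => b - a ∈ localEnv ω a) flip ?_ 0 z h
  rintro a b ⟨hocc, hstep⟩
  refine ⟨by rwa [reflect, flip_involutive], ?_⟩
  rw [sub_mem_steps_iff] at hstep ⊢
  simp only [flip]
  lia

lemma mem_forwardCluster_reflect_iff {z : ℤ × ℤ} :
    z ∈ forwardCluster (reflect ω) 0 ↔ flip z ∈ forwardCluster ω 0 := by
  refine ⟨fun h => ?_, fun h => ?_⟩
  · simpa only [reflect_reflect] using flip_mem_forwardCluster_reflect h
  · simpa only [flip_involutive z] using flip_mem_forwardCluster_reflect h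

lemma infinite_forwardCluster_reflect (h : (forwardCluster ω 0).Infinite) :
    (forwardCluster (reflect ω) 0).Infinite :=
  (h.image flip_involutive.injective.injOn).mono
    (Set.image_subset_iff.2 fun _ => flip_mem_forwardCluster_reflect)

lemma mem_column_reflect {m : ℕ} {x : ℤ} :
    x ∈ column (reflect ω) m ↔ (-x, (m : ℤ)) ∈ forwardCluster ω 0 :=
  mem_forwardCluster_reflect_iff.trans (by simp [flip])

end Reflection

variable {p : unitInterval} {l : ℝ}

lemma tendsto_topRun_div (hp1 : p < 1) :
    ∀ᵐ η ∂percLaw p, Tendsto (fun n : ℕ => (topRun η n : ℝ) / n) atTop (𝓝 0) := by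
  filter_upwards [tendsto_runSum hp1] with η hη
  have hdiff := (tendsto_succ_div hη).sub hη
  rw [sub_self] at hdiff
  refine hdiff.congr fun n => ?_
  rw [runSum, runSum, Finset.sum_range_succ, Nat.cast_add, ← sub_div, add_sub_cancel_left]

lemma Typical.exists_isGreatest_column (htyp : Typical (toEnv ω)) (hs : Survives (toEnv ω))
    (n : ℕ) : ∃ w, IsGreatest (column ω n) w ∧ top (toEnv ω) n ≤ w ∧
      w ≤ top (toEnv ω) n + topRun (toEnv ω) n := by
  have htop : top (toEnv ω) n ∈ column ω n :=
    entry_subset_column n (htyp.top_mem_of_nonempty (hs n))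
  have hbdd : BddAbove (column ω n) := ⟨_, fun _ => htyp.le_top_add_topRun⟩
  have hmem := Int.csSup_mem ⟨_, htop⟩ hbdd
  exact ⟨_, ⟨hmem, fun _ => le_csSup hbdd⟩, le_csSup hbdd htop, htyp.le_top_add_topRun hmem⟩

lemma ae_exists_isGreatest_column (hp0 : 0 < p) (hp1 : p < 1) (hl : IsSlope p l) :
    ∀ᵐ ω ∂law p, (forwardCluster ω 0).Infinite → ∃ w : ℕ → ℤ,
      (∀ n, IsGreatest (column ω n) (w n)) ∧
        Tendsto (fun n : ℕ => (w n : ℝ) / n) atTop (𝓝 l) := by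
  have hae := (measurePreserving_toEnv p).quasiMeasurePreserving
  filter_upwards [hae.ae (ae_typical hp0 hp1), hae.ae hl, hae.ae (tendsto_topRun_div hp1)]
    with ω htyp hslope hrun hinf
  have hs := htyp.survives_of_infinite hinf
  choose w hw hlower hupper using htyp.exists_isGreatest_column hs
  have hsum : Tendsto (fun n : ℕ => (top (toEnv ω) n : ℝ) / n + (topRun (toEnv ω) n : ℝ) / n)
      atTop (𝓝 l) := by
    simpa using (hslope hs).add hrun
  refine ⟨w, hw, tendsto_of_tendsto_of_tendsto_of_le_of_le (hslope hs) hsum (fun n => ?_)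
    (fun n => ?_)⟩
  · exact div_le_div_of_nonneg_right (Int.cast_le.2 (hlower n)) n.cast_nonneg
  · simp only [← add_div]
    exact div_le_div_of_nonneg_right (by exact_mod_cast hupper n) n.cast_nonneg

lemma exists_isLeast_column {n : ℕ} (h : (column ω n).Nonempty) :
    ∃ v : ℕ, IsLeast (column ω n) v := by
  have hbdd : BddBelow (column ω n) := ⟨0, fun _ => nonneg_of_mem_forwardCluster⟩
  have hmem := Int.csInf_mem h hbdd
  obtain ⟨v, hv⟩ := Int.eq_ofNat_of_zero_le (nonneg_of_mem_forwardCluster hmem)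
  exact ⟨v, hv ▸ ⟨hmem, fun _ => csInf_le hbdd⟩⟩

/- The lowest points `v n` of the columns and the leftmost points `a m` of the rows are inverse to
each other: `a (v n - 1) < n ≤ a (v n)`. -/
lemma tendsto_natCast_div_lowest {a : ℕ → ℤ} {v : ℕ → ℕ} (hv : ∀ n, IsLeast (column ω n) (v n))
    (ha : ∀ m, IsGreatest (column (reflect ω) m) (a m))
    (hal : Tendsto (fun m : ℕ => (a m : ℝ) / m) atTop (𝓝 l)) :
    Tendsto v atTop atTop ∧ Tendsto (fun n : ℕ => (n : ℝ) / v n) atTop (𝓝 l) := by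
  have hle : ∀ n : ℕ, (n : ℤ) ≤ a (v n) := fun n => (ha (v n)).2 (mem_column_reflect.2 (hv n).1)
  have hlt : ∀ n : ℕ, 0 < v n → a (v n - 1) < n := by
    intro n hn
    by_contra! hcon
    obtain ⟨y, hy, hyv⟩ := exists_mem_column_le (mem_column_reflect.1 (ha (v n - 1)).1)
      (neg_le_neg hcon)
    have := (hv n).2 hy
    lia
  have hvtop : Tendsto v atTop atTop := by
    refine tendsto_atTop.2 fun M => ?_
    filter_upwards [eventually_gt_atTop (∑ m ∈ Finset.range M, (a m).natAbs)] with n hn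
    by_contra! hM
    have hsingle := Finset.single_le_sum (f := fun m => (a m).natAbs) (fun _ _ => Nat.zero_le _)
      (Finset.mem_range.2 hM)
    have := hle n
    lia
  refine ⟨hvtop, tendsto_natCast_div_of_le_of_le_succ (tendsto_pred_div hal) hvtop ?_
    (.of_forall fun n => by exact_mod_cast hle n)⟩
  filter_upwards [hvtop.eventually_gt_atTop 0] with n hn
  exact_mod_cast (hlt n hn).le

lemma ae_exists_boundaries (hp0 : 0 < p) (hp1 : p < 1) (hl : IsSlope p l) :
    ∀ᵐ ω ∂law p, (forwardCluster ω 0).Infinite → ∃ w : ℕ → ℤ, ∃ v : ℕ → ℕ,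
      (∀ n, IsGreatest (column ω n) (w n)) ∧ (∀ n, IsLeast (column ω n) (v n)) ∧
      Tendsto v atTop atTop ∧
      Tendsto (fun n : ℕ => (w n : ℝ) / n) atTop (𝓝 l) ∧
      Tendsto (fun n : ℕ => (n : ℝ) / v n) atTop (𝓝 l) := by
  have hgreatest := ae_exists_isGreatest_column hp0 hp1 hl
  filter_upwards [hgreatest, (measurePreserving_reflect p).quasiMeasurePreserving.ae hgreatest]
    with ω hcol hrow hinf
  obtain ⟨w, hw, hwl⟩ := hcol hinf
  obtain ⟨a, ha, hal⟩ := hrow (infinite_forwardCluster_reflect hinf)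
  choose v hv using fun n => exists_isLeast_column ⟨w n, (hw n).1⟩
  obtain ⟨hvtop, hvl⟩ := tendsto_natCast_div_lowest hv ha hal
  exact ⟨w, v, hw, hv, hvtop, hwl, hvl⟩

end Cluster

section CriticalValue

variable {p q : unitInterval}

lemma percProb_le_percLaw_survives (hp0 : 0 < p) (hp1 : p < 1) :
    percProb p ≤ percLaw p {ω | Survives ω} := by
  rw [← (measurePreserving_toEnv p).measure_preimage measurableSet_survives.nullMeasurableSet]
  refine measure_mono_ae ?_
  filter_upwards [(measurePreserving_toEnv p).quasiMeasurePreserving.ae (ae_typical hp0 hp1)]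
    with ω htyp hinf
  exact htyp.survives_of_infinite hinf

lemma percProb_zero : percProb 0 = 0 := by
  have hfin : (forwardCluster (fun _ => false) 0).Finite := by
    refine (Set.finite_singleton 0).subset fun z hz => ?_
    induction hz with
    | refl => rfl
    | tail _ h _ => exact absurd h.1 (by simp)
  rw [percProb, law]
  simp only [bernoulliMeasure_zero]
  rw [Measure.infinitePi_dirac, Measure.dirac_apply]
  exact Set.indicator_of_notMem (s := {ω | (forwardCluster ω 0).Infinite}) (fun h => h hfin) _

/- On percolation the lower boundary `n / l` is below the upper boundary `n * l`. -/
lemma IsSlope.one_le {l : ℝ} (hl : IsSlope q l) (hl0 : 0 ≤ l) (hq0 : 0 < q) (hq1 : q < 1)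
    (hperc : 0 < percProb q) : 1 ≤ l := by
  have hfreq : ∃ᵐ ω ∂law q, (forwardCluster ω 0).Infinite := frequently_ae_iff.2 hperc.ne'
  obtain ⟨ω, hinf, hω⟩ := (hfreq.and_eventually (ae_exists_boundaries hq0 hq1 hl)).exists
  obtain ⟨w, v, hw, hv, hvtop, hwl, hvl⟩ := hω hinf
  have hsq : 1 ≤ l * l := by
    refine ge_of_tendsto (hvl.mul hwl) ?_
    filter_upwards [eventually_gt_atTop 0, hvtop.eventually_gt_atTop 0] with n hn hvn
    rw [mul_comm, div_mul_div_cancel₀ (Nat.cast_ne_zero.2 hn.ne'), one_le_div (Nat.cast_pos.2 hvn)]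
    exact_mod_cast (hw n).2 (hv n).1
  nlinarith

lemma exists_one_lt_isSlope (hpc : criticalValue < p) (hp1 : p < 1) :
    ∃ l : ℝ, 1 < l ∧ IsSlope p l := by
  obtain ⟨q, hperc : 0 < percProb q, hqp⟩ := sInf_lt_iff.1 hpc
  have hq0 : 0 < q := unitInterval.pos_iff_ne_zero.2 fun h => by simp [h, percProb_zero] at hperc
  have hq1 := hqp.trans hp1
  have hθq := hperc.trans_le (percProb_le_percLaw_survives hq0 hq1)
  have hθp := hθq.trans_le (percLaw_survives_mono hqp.le)
  obtain ⟨l, hl0, hl⟩ := exists_isSlope hq0 hq1 hθq.ne'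
  obtain ⟨l', -, hl'⟩ := exists_isSlope (hq0.trans hqp) hp1 hθp.ne'
  have hone := hl.one_le hl0 hq0 hq1 hperc
  have hadd := hl.add_le hl' hq0 hqp.le hp1 hθq.ne'
  have hsub : 0 < (p : ℝ) - q := sub_pos.2 hqp
  exact ⟨l', by linarith, hl'⟩

end CriticalValue

section Boundary

variable {ω : Config} {l : ℝ}

lemma upper_eq {n : ℕ} {w : ℤ} (h : IsGreatest (column ω n) w) :
    upper ω n = ((w : ℝ) : EReal) :=
  le_antisymm (iSup₂_le fun _ hx => EReal.coe_le_coe_iff.2 (Int.cast_le.2 (h.2 hx)))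
    (le_iSup₂_of_le w h.1 le_rfl)

lemma lower_eq {n : ℕ} {v : ℤ} (h : IsLeast (column ω n) v) : lower ω n = ((v : ℝ) : EReal) :=
  le_antisymm (iInf₂_le_of_le v h.1 le_rfl)
    (le_iInf₂ fun _ hx => EReal.coe_le_coe_iff.2 (Int.cast_le.2 (h.2 hx)))

lemma tendsto_upper_div {w : ℕ → ℤ} (hw : ∀ n, IsGreatest (column ω n) (w n))
    (hwl : Tendsto (fun n : ℕ => (w n : ℝ) / n) atTop (𝓝 l)) :
    Tendsto (fun n : ℕ => upper ω n / (-((n : ℝ) : EReal))) atTop (𝓝 ((-l : ℝ) : EReal)) := by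
  refine ((continuous_coe_real_ereal.tendsto _).comp hwl.neg).congr fun n => ?_
  rw [upper_eq (hw n), ← EReal.coe_neg, ← EReal.coe_div, Function.comp_apply, div_neg]

lemma tendsto_lower_div (hl : l ≠ 0) {v : ℕ → ℕ} (hv : ∀ n, IsLeast (column ω n) (v n))
    (hvl : Tendsto (fun n : ℕ => (n : ℝ) / v n) atTop (𝓝 l)) :
    Tendsto (fun n : ℕ => lower ω n / (-((n : ℝ) : EReal))) atTop
      (𝓝 ((1 / -l : ℝ) : EReal)) := by
  have hinv : Tendsto (fun n : ℕ => -((n : ℝ) / v n)⁻¹) atTop (𝓝 (1 / -l)) := by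
    rw [one_div, inv_neg]
    exact (hvl.inv₀ hl).neg
  refine ((continuous_coe_real_ereal.tendsto _).comp hinv).congr fun n => ?_
  rw [lower_eq (hv n), ← EReal.coe_neg, ← EReal.coe_div, Function.comp_apply, div_neg, inv_div,
    Int.cast_natCast]

end Boundary

end OTSP

theorem proposition1 (p : unitInterval) (hpc : OTSP.criticalValue < p) (hp1 : p < 1) :
    ∃ ρ : ℝ, ρ < -1 ∧
      ∀ᵐ ω ∂(OTSP.law p), (OTSP.forwardCluster ω 0).Infinite →
        Tendsto (fun n : ℕ => OTSP.upper ω n / (-((n : ℝ) : EReal))) atTop (𝓝 (ρ : EReal)) ∧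
        Tendsto (fun n : ℕ => OTSP.lower ω n / (-((n : ℝ) : EReal))) atTop
          (𝓝 ((1 / ρ : ℝ) : EReal)) := by
  have hp0 : 0 < p := unitInterval.nonneg'.trans_lt hpc
  obtain ⟨l, hl1, hl⟩ := OTSP.exists_one_lt_isSlope hpc hp1
  refine ⟨-l, neg_lt_neg hl1, ?_⟩
  filter_upwards [OTSP.ae_exists_boundaries hp0 hp1 hl] with ω hω hinf
  obtain ⟨w, v, hw, hv, -, hwl, hvl⟩ := hω hinf
  exact ⟨OTSP.tendsto_upper_div hw hwl,
    OTSP.tendsto_lower_div (zero_lt_one.trans hl1).ne' hv hvl⟩
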